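/- Setting. There are $M$ clients; client $m$ has a distribution $\mathcal D_m$ of samples $\xi$, and $f(x;\xi)$ is a stochastic objective on $\mathbb R^d$. Put $F_m(x)=\mathbb E_{\xi\sim\mathcal D_m} f(x;\xi)$ and $F(x)=\frac1M\sum_{m=1}^M F_m(x)$. FedAvg with step size $\eta$, started at $x^{(0,0)}$, runs for rounds $r=0,\dots,R-1$: every client sets $x_m^{(r,0)}=x^{(r,0)}$ and makes $K$ local steps $x_m^{(r,k+1)}=x_m^{(r,k)}-\eta\nabla f(x_m^{(r,k)};\xi_m^{(r,k)})$, where the samples $\xi_m^{(r,k)}\sim\mathcal D_m$ are all independent; then $x^{(r+1,0)}=\frac1M\sum_{m=1}^M x_m^{(r,K)}$. Theorem. There is an absolute constant $c>0$ such that the following holds for all integers $K\ge 2$, $R\ge 1$, $M\ge 1$ and all reals $H>0$, $D>0$, $\sigma\ge 0$, $\zeta_*\ge 0$, where $M\ge 2$ unless $\zeta_*=0$. There exist a dimension $d$, a stochastic objective $f(x;\xi)$ on $\mathbb R^d$, distributions $\mathcal D_1,\dots,\mathcal D_M$, a minimizer $x^\star$ of $F$ and an initialization $x^{(0,0)}$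 with $\|x^{(0,0)}-x^\star\|_2<D$ such that (a) for every $\xi$, the function $f(\cdot;\xi)$ is twice differentiable, convex and $H$-smooth (its gradient is $H$-Lipschitz in the Euclidean norm), and $\mathbb E_{\xi\sim\mathcal D_m}\|\nabla f(x;\xi)-\nabla F_m(x)\|_2^2\le\sigma^2$ for every $x$ and every $m$; (b) $\frac1M\sum_{m=1}^M\|\nabla F_m(x^\star)\|_2^2\le\zeta_*^2$; (c) if $\zeta_*=0$, then all the distributions $\mathcal D_m$ are equal; (d) for every step size $\eta$, the final iterate of FedAvg started at $x^{(0,0)}$ has finite expected loss and satisfies $$\mathbb E\big[F(x^{(R,0)})\big]-F(x^\star)\ \ge\ c\,\min\left\{HD^2,\ \frac{HD^2}{KR}+\frac{\sigma D}{\sqrt{MKR}}+\min\left\{\frac{\sigma D}{\sqrt{KR}},\frac{H^{1/3}\sigma^{2/3}D^{4/3}}{K^{1/3}R^{2/3}}\right\}+\min\left\{\frac{\zeta_*^2}{H},\frac{H^{1/3}\zeta_*^{2/3}D^{4/3}}{R^{2/3}}\right\}\right\}.$$ -/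

import Mathlib

open MeasureTheory ProbabilityTheory

noncomputable section

namespace FedAvg

/-- The expected loss `F_𝒟(x) = 𝔼_{ξ ∼ 𝒟} f(x; ξ)` of a stochastic objective `f(x; ξ)`. -/
def expectedLoss {d : ℕ} {Ξ : Type*} [MeasurableSpace Ξ]
    (f : EuclideanSpace ℝ (Fin d) → Ξ → ℝ) (𝒟 : Measure Ξ)
    (x : EuclideanSpace ℝ (Fin d)) : ℝ :=
  ∫ ξ, f x ξ ∂𝒟

/-- The global objective `F(x) = (1/M) ∑ₘ F_m(x)` with `F_m(x) = 𝔼_{ξ ∼ 𝒟_m} f(x; ξ)`. -/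
def globalLoss {d M : ℕ} {Ξ : Type*} [MeasurableSpace Ξ]
    (f : EuclideanSpace ℝ (Fin d) → Ξ → ℝ) (𝒟 : Fin M → ProbabilityMeasure Ξ)
    (x : EuclideanSpace ℝ (Fin d)) : ℝ :=
  (M : ℝ)⁻¹ * ∑ m, expectedLoss f (𝒟 m : Measure Ξ) x

/-- The stochastic gradient `∇f(x; ξ)`, taken with respect to `x`. -/
def stochGrad {d : ℕ} {Ξ : Type*} (f : EuclideanSpace ℝ (Fin d) → Ξ → ℝ)
    (x : EuclideanSpace ℝ (Fin d)) (ξ : Ξ) : EuclideanSpace ℝ (Fin d) :=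
  gradient (fun y => f y ξ) x

/-- The standing assumption on a stochastic objective `f(x; ξ)`, `ξ ∼ 𝒟`: the function `f(·; ξ)`
is twice differentiable, convex and `H`-smooth for every `ξ`, and the stochastic gradient has
variance at most `σ²` at every point. The first two fields only say that the expected loss is
well defined. -/
structure ConvexSmoothBoundedVariance {d : ℕ} {Ξ : Type*} [MeasurableSpace Ξ]
    (f : EuclideanSpace ℝ (Fin d) → Ξ → ℝ) (𝒟 : Measure Ξ) (H σ : ℝ) : Prop where
  measurable : ∀ x, Measurable (f x)
  integrable : ∀ x, Integrable (f x) 𝒟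
  differentiable : ∀ ξ, Differentiable ℝ (fun x => f x ξ)
  twice_differentiable : ∀ ξ, Differentiable ℝ (fun x => stochGrad f x ξ)
  convex : ∀ ξ, ConvexOn ℝ Set.univ (fun x => f x ξ)
  smooth : ∀ ξ x y, ‖stochGrad f x ξ - stochGrad f y ξ‖ ≤ H * ‖x - y‖
  variance_integrable : ∀ x,
    Integrable (fun ξ => ‖stochGrad f x ξ - gradient (expectedLoss f 𝒟) x‖ ^ 2) 𝒟
  variance_le : ∀ x,
    ∫ ξ, ‖stochGrad f x ξ - gradient (expectedLoss f 𝒟) x‖ ^ 2 ∂𝒟 ≤ σ ^ 2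

/-- Gradient heterogeneity at the point `z` is at most `ζ²`:
`(1/M) ∑ₘ ‖∇F_m(z)‖² ≤ ζ²`. -/
def HeterogeneityAtMost {d M : ℕ} {Ξ : Type*} [MeasurableSpace Ξ]
    (f : EuclideanSpace ℝ (Fin d) → Ξ → ℝ) (𝒟 : Fin M → ProbabilityMeasure Ξ)
    (z : EuclideanSpace ℝ (Fin d)) (ζ : ℝ) : Prop :=
  (M : ℝ)⁻¹ * ∑ m, ‖gradient (expectedLoss f (𝒟 m : Measure Ξ)) z‖ ^ 2 ≤ ζ ^ 2

/-- `k` local steps of SGD with step size `η` from `x`, step `i` using the sample `s i`. -/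
def localSGD {d : ℕ} {Ξ : Type*} (f : EuclideanSpace ℝ (Fin d) → Ξ → ℝ) (η : ℝ)
    (s : ℕ → Ξ) (x : EuclideanSpace ℝ (Fin d)) : ℕ → EuclideanSpace ℝ (Fin d)
  | 0 => x
  | k + 1 => localSGD f η s x k - η • stochGrad f (localSGD f η s x k) (s k)

/-- The server iterate `x^{(r,0)}` of FedAvg with `M` clients, `K` local steps per round, step size
`η` and initialization `x₀`; client `m` uses the sample `s r k m` in local step `k` of round `r`. -/
def serverIterate {d M : ℕ} {Ξ : Type*} (f : EuclideanSpace ℝ (Fin d) → Ξ → ℝ) (η : ℝ)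
    (K : ℕ) (s : ℕ → ℕ → Fin M → Ξ) (x₀ : EuclideanSpace ℝ (Fin d)) :
    ℕ → EuclideanSpace ℝ (Fin d)
  | 0 => x₀
  | r + 1 =>
      (M : ℝ)⁻¹ • ∑ m, localSGD f η (fun k => s r k m) (serverIterate f η K s x₀ r) K

/-- The random samples `ξ r k m` are mutually independent, and `ξ r k m ∼ 𝒟_m`. -/
structure IsSampling {M : ℕ} {Ξ Ω : Type*} [MeasurableSpace Ξ] [MeasurableSpace Ω]
    (ξ : ℕ → ℕ → Fin M → Ω → Ξ) (𝒟 : Fin M → ProbabilityMeasure Ξ) (P : Measure Ω) :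
    Prop where
  measurable : ∀ r k m, Measurable (ξ r k m)
  law : ∀ r k m, P.map (ξ r k m) = (𝒟 m : Measure Ξ)
  indep : iIndepFun (fun i : ℕ × ℕ × Fin M => ξ i.1 i.2.1 i.2.2) P

end FedAvg

end

/-! Up to a factor of four, the sum in the bound is its largest term, and the instance may depend on
all parameters. So it suffices to build one hard instance per term, each with loss of order `min (H
* D ^ 2)` of that term (`min_add_add_add_le`).

All instances are separable on `ℝ³`, and `hardInstance_sepLoss` reduces them to a scalar problem.
The first coordinate has curvature `H` and never contracts unless `0 ≤ η ≤ 2 / H`. The second has a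
small curvature `h`, with `h * D ^ 2` of the order of the loss sought, and stays of order `D` unless
`η * h * K * R ≥ 1 / 2`. Only step sizes in this window remain, and for them the third coordinate
must be shown to be costly.

For the deterministic term, `h` is chosen so that the window is empty. For the variance term the
third coordinate is a quadratic of curvature `h`, and the averaged noise accumulates in the mean
square.

The other two terms use an asymmetric function with curvature about `H / 4` on the left and `H / 16`
on the right. Its gradient `g` satisfies `g y ≤ a * y` for both `a = H / 4` and `a = H / 16`. Hence
each local run is bounded below by a linear recursion with either slope, and the slope may be chosen
by the spread accumulated so far: the flatter one where the iterate has been pushed to the right.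
The spread comes from gradient noise (`scalarSGD_drift`) or from clients pulling in opposite
directions (`hardInstance_heterogeneous`). Averaging cancels the symmetric part and leaves a
positive drift per round. Over `R` rounds the drift builds up against the contraction `(1 - η * H /
4) ^ K` (`drift_le_of_recursion`), so the mean ends far to the right of the minimizer. Jensen's
inequality and strong convexity turn this into a loss. -/

noncomputable section

namespace FedAvg

/-- For the given parameters there is an instance on which the final iterate of FedAvg has expected
suboptimality at least `v`, for every step size. -/
def HardInstance.{u} (K R M : ℕ) (H D σ ζ v : ℝ) : Prop :=
  ∃ (d : ℕ) (Ξ : Type) (_ : MeasurableSpace Ξ)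
    (f : EuclideanSpace ℝ (Fin d) → Ξ → ℝ)
    (𝒟 : Fin M → ProbabilityMeasure Ξ)
    (xstar x₀ : EuclideanSpace ℝ (Fin d)),
    (∀ m, ConvexSmoothBoundedVariance f (𝒟 m : Measure Ξ) H σ) ∧
    (∀ x, globalLoss f 𝒟 xstar ≤ globalLoss f 𝒟 x) ∧
    HeterogeneityAtMost f 𝒟 xstar ζ ∧
    (ζ = 0 → ∀ m m', 𝒟 m = 𝒟 m') ∧
    ‖x₀ - xstar‖ < D ∧
    ∀ (η : ℝ) (Ω : Type u) (_ : MeasurableSpace Ω) (P : Measure Ω)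
      (_ : IsProbabilityMeasure P) (ξ : ℕ → ℕ → Fin M → Ω → Ξ),
      IsSampling ξ 𝒟 P →
      Integrable (fun ω => globalLoss f 𝒟
        (serverIterate f η K (fun r k m => ξ r k m ω) x₀ R)) P ∧
      v ≤ (∫ ω, globalLoss f 𝒟 (serverIterate f η K (fun r k m => ξ r k m ω) x₀ R) ∂P)
          - globalLoss f 𝒟 xstar

theorem HardInstance.mono.{u} {K R M : ℕ} {H D σ ζ v w : ℝ}
    (hv : HardInstance.{u} K R M H D σ ζ v) (hw : w ≤ v) : HardInstance.{u} K R M H D σ ζ w := by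
  obtain ⟨d, Ξ, i, f, 𝒟, xs, x0, h1, h2, h3, h4, h5, h6⟩ := hv
  refine ⟨d, Ξ, i, f, 𝒟, xs, x0, h1, h2, h3, h4, h5, fun η Ω j P k ξ hξ => ?_⟩
  exact ⟨(h6 η Ω j P k ξ hξ).1, hw.trans (h6 η Ω j P k ξ hξ).2⟩

/-! ### Scalar gradients with bounded slopes and their primitives -/

/-- `g` is differentiable and all its difference quotients lie in `[μ, H]`. -/
structure SlopeBounds (g : ℝ → ℝ) (μ H : ℝ) : Prop where
  differentiable : Differentiable ℝ g
  lower : ∀ x y, x ≤ y → μ * (y - x) ≤ g y - g x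
  upper : ∀ x y, x ≤ y → g y - g x ≤ H * (y - x)

namespace SlopeBounds

variable {g : ℝ → ℝ} {μ H : ℝ}

theorem hasDerivAt_integral (hg : SlopeBounds g μ H) (x : ℝ) :
    HasDerivAt (fun y => ∫ t in (0 : ℝ)..y, g t) (g x) x :=
  intervalIntegral.integral_hasDerivAt_right (hg.differentiable.continuous.intervalIntegrable _ _)
    (hg.differentiable.continuous.stronglyMeasurableAtFilter _ _)
    hg.differentiable.continuous.continuousAt

theorem continuous_integral (hg : SlopeBounds g μ H) :
    Continuous (fun y => ∫ t in (0 : ℝ)..y, g t) :=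
  continuous_iff_continuousAt.2 fun x => (hg.hasDerivAt_integral x).continuousAt

theorem monotone (hg : SlopeBounds g μ H) (hμ : 0 ≤ μ) : Monotone g := fun x y hxy => by
  have := hg.lower x y hxy
  have := mul_nonneg hμ (sub_nonneg.2 hxy)
  linarith

theorem convexOn_integral (hg : SlopeBounds g μ H) (hμ : 0 ≤ μ) :
    ConvexOn ℝ Set.univ (fun y => ∫ t in (0 : ℝ)..y, g t) := by
  apply Monotone.convexOn_univ_of_deriv
  · exact fun x => (hg.hasDerivAt_integral x).differentiableAt
  · have : deriv (fun y => ∫ t in (0 : ℝ)..y, g t) = g :=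
      funext fun x => (hg.hasDerivAt_integral x).deriv
    rw [this]
    exact hg.monotone hμ

theorem abs_sub_le (hg : SlopeBounds g μ H) (hμ : 0 ≤ μ) (x y : ℝ) :
    |g x - g y| ≤ H * |x - y| := by
  rcases le_total x y with h | h
  · rw [abs_sub_comm, abs_sub_comm x, abs_of_nonneg (sub_nonneg.2 h),
      abs_of_nonneg (sub_nonneg.2 (hg.monotone hμ h))]
    exact hg.upper x y h
  · rw [abs_of_nonneg (sub_nonneg.2 h), abs_of_nonneg (sub_nonneg.2 (hg.monotone hμ h))]
    exact hg.upper y x h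

/-- Subtracting `μ / 2 * (y - z) ^ 2` from the primitive leaves a function whose derivative has the
sign of `y - z`, hence a minimum at `z`. -/
theorem integral_quadratic_growth (hg : SlopeBounds g μ H) {z : ℝ} (hz : g z = 0) (x : ℝ) :
    μ / 2 * (x - z) ^ 2 ≤ (∫ t in (0 : ℝ)..x, g t) - ∫ t in (0 : ℝ)..z, g t := by
  have hd : ∀ y, HasDerivAt (fun y => (∫ t in (0 : ℝ)..y, g t) - μ / 2 * (y - z) ^ 2)
      (g y - μ * (y - z)) y := fun y => by
    have h2 : HasDerivAt (fun y : ℝ => μ / 2 * (y - z) ^ 2) (μ / 2 * (2 * (y - z))) y := by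
      simpa using (((hasDerivAt_id y).sub_const z).pow 2).const_mul (μ / 2)
    exact ((hg.hasDerivAt_integral y).sub h2).congr_deriv (by ring)
  have hc : Continuous (fun y => (∫ t in (0 : ℝ)..y, g t) - μ / 2 * (y - z) ^ 2) :=
    continuous_iff_continuousAt.2 fun y => (hd y).continuousAt
  have key : (∫ t in (0 : ℝ)..z, g t) - μ / 2 * (z - z) ^ 2 ≤
      (∫ t in (0 : ℝ)..x, g t) - μ / 2 * (x - z) ^ 2 := by
    rcases le_total z x with h | h
    · refine monotoneOn_of_deriv_nonneg (convex_Ici z) hc.continuousOn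
        (fun y _ => (hd y).differentiableAt.differentiableWithinAt) (fun y hy => ?_)
        (Set.mem_Ici.2 le_rfl) (Set.mem_Ici.2 h) h
      rw [(hd y).deriv]
      have := hg.lower z y (by simpa using (interior_subset hy : y ∈ Set.Ici z))
      linarith
    · refine antitoneOn_of_deriv_nonpos (convex_Iic z) hc.continuousOn
        (fun y _ => (hd y).differentiableAt.differentiableWithinAt) (fun y hy => ?_)
        (Set.mem_Iic.2 h) (Set.mem_Iic.2 le_rfl) h
      rw [(hd y).deriv]
      have := hg.lower y z (by simpa using (interior_subset hy : y ∈ Set.Iic z))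
      linarith
  simp only [sub_self] at key
  linarith

end SlopeBounds

/-! ### The separable objective -/

/-- A separable objective on `ℝ³`: two quadratics and a primitive of `g`, with a random linear term
in the last coordinate. -/
def sepLoss {Ξ : Type*} (H h : ℝ) (g : ℝ → ℝ) (u : Ξ → ℝ) (x : EuclideanSpace ℝ (Fin 3)) (s : Ξ) :
    ℝ :=
  H / 2 * x 0 ^ 2 + h / 2 * x 1 ^ 2 + (∫ t in (0 : ℝ)..x 2, g t) + u s * x 2

section sepLoss

variable {Ξ : Type*} {H h μ : ℝ} {g : ℝ → ℝ}

theorem hasGradientAt_sepLoss (hg : SlopeBounds g μ H) (u : Ξ → ℝ) (s : Ξ)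
    (x : EuclideanSpace ℝ (Fin 3)) :
    HasGradientAt (fun y => sepLoss H h g u y s) !₂[H * x 0, h * x 1, g (x 2) + u s] x := by
  rw [hasGradientAt_iff_hasFDerivAt]
  have hp : ∀ i : Fin 3, HasFDerivAt (fun y : EuclideanSpace ℝ (Fin 3) => y i)
      (EuclideanSpace.proj i : EuclideanSpace ℝ (Fin 3) →L[ℝ] ℝ) x := fun i =>
    (EuclideanSpace.proj i : EuclideanSpace ℝ (Fin 3) →L[ℝ] ℝ).hasFDerivAt
  have h0 := ((hp 0).pow 2).const_mul (H / 2)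
  have h1 := ((hp 1).pow 2).const_mul (h / 2)
  have h2 := (hg.hasDerivAt_integral (x 2)).comp_hasFDerivAt x (hp 2)
  have h3 := (hp 2).const_mul (u s)
  refine (((h0.add h1).add h2).add h3).congr_fderiv ?_
  ext v
  simp [PiLp.inner_apply, Fin.sum_univ_three]
  ring

theorem stochGrad_sepLoss (hg : SlopeBounds g μ H) (u : Ξ → ℝ) (s : Ξ)
    (x : EuclideanSpace ℝ (Fin 3)) :
    stochGrad (sepLoss H h g u) x s = !₂[H * x 0, h * x 1, g (x 2) + u s] :=
  (hasGradientAt_sepLoss hg u s x).gradient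

theorem convexOn_sepLoss (hg : SlopeBounds g μ H) (hμ : 0 ≤ μ) (hH : 0 ≤ H) (hh : 0 ≤ h)
    (u : Ξ → ℝ) (s : Ξ) : ConvexOn ℝ Set.univ (fun y => sepLoss H h g u y s) := by
  have hp := fun (i : Fin 3) (φ : ℝ → ℝ) (hφ : ConvexOn ℝ Set.univ φ) =>
    hφ.comp_linearMap (EuclideanSpace.proj i : EuclideanSpace ℝ (Fin 3) →L[ℝ] ℝ).toLinearMap
  have hsq : ConvexOn ℝ Set.univ (fun t : ℝ => t ^ 2) := even_two.convexOn_pow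
  have h0 := hp 0 _ (hsq.smul (by positivity : (0 : ℝ) ≤ H / 2))
  have h1 := hp 1 _ (hsq.smul (by positivity : (0 : ℝ) ≤ h / 2))
  have h2 := hp 2 _ (hg.convexOn_integral hμ)
  have h3 := hp 2 (fun t => u s * t) ((LinearMap.mul ℝ ℝ (u s)).convexOn convex_univ)
  exact ((h0.add h1).add h2).add h3

theorem norm_le_of_forall_abs_le {n : ℕ} {v w : EuclideanSpace ℝ (Fin n)} {c : ℝ} (hc : 0 ≤ c)
    (hvw : ∀ i, |v i| ≤ c * |w i|) : ‖v‖ ≤ c * ‖w‖ := by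
  refine abs_le_of_sq_le_sq' ?_ (by positivity) |>.2
  rw [mul_pow, EuclideanSpace.norm_sq_eq, EuclideanSpace.norm_sq_eq, Finset.mul_sum]
  refine Finset.sum_le_sum fun i _ => ?_
  rw [Real.norm_eq_abs, Real.norm_eq_abs, ← mul_pow]
  exact pow_le_pow_left₀ (abs_nonneg _) (hvw i) 2

theorem stochGrad_sepLoss_lipschitz (hg : SlopeBounds g μ H) (hμ : 0 ≤ μ) (hh : 0 ≤ h)
    (hhH : h ≤ H) (u : Ξ → ℝ) (s : Ξ) (x y : EuclideanSpace ℝ (Fin 3)) :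
    ‖stochGrad (sepLoss H h g u) x s - stochGrad (sepLoss H h g u) y s‖ ≤ H * ‖x - y‖ := by
  have hH : 0 ≤ H := hh.trans hhH
  rw [stochGrad_sepLoss hg, stochGrad_sepLoss hg]
  refine norm_le_of_forall_abs_le hH fun i => ?_
  fin_cases i
  · simp [← mul_sub, abs_mul, abs_of_nonneg hH]
  · simp only [Fin.mk_one, PiLp.sub_apply, Matrix.cons_val_one, Matrix.cons_val_zero, ← mul_sub,
      abs_mul, abs_of_nonneg hh]
    gcongr
  · simpa using hg.abs_sub_le hμ (x 2) (y 2)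

theorem differentiable_stochGrad_sepLoss (hg : SlopeBounds g μ H) (u : Ξ → ℝ) (s : Ξ) :
    Differentiable ℝ (fun x => stochGrad (sepLoss H h g u) x s) := by
  simp only [stochGrad_sepLoss hg]
  rw [differentiable_euclidean]
  have hp : ∀ i : Fin 3, Differentiable ℝ (fun y : EuclideanSpace ℝ (Fin 3) => y i) := fun i =>
    (EuclideanSpace.proj i : EuclideanSpace ℝ (Fin 3) →L[ℝ] ℝ).differentiable
  intro i
  fin_cases i
  · exact (hp 0).const_mul H
  · exact (hp 1).const_mul h
  · exact (hg.differentiable.comp (hp 2)).add_const (u s)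

variable [MeasurableSpace Ξ] [Finite Ξ] [MeasurableSingletonClass Ξ]

/-- Since the randomness enters linearly, taking expectations stays in the family `sepLoss`, now
with a constant linear term, so the gradient formula applies to the expected loss too. -/
theorem expectedLoss_sepLoss (u : Ξ → ℝ) (𝒟 : Measure Ξ) [IsProbabilityMeasure 𝒟] :
    expectedLoss (sepLoss H h g u) 𝒟 =
      fun x => sepLoss H h g (fun _ : Unit => ∫ s, u s ∂𝒟) x () := by
  funext x
  simp only [expectedLoss, sepLoss]
  rw [integral_add (integrable_const _) Integrable.of_finite, integral_const, integral_mul_const]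
  simp

theorem gradient_expectedLoss_sepLoss (hg : SlopeBounds g μ H) (u : Ξ → ℝ) (𝒟 : Measure Ξ)
    [IsProbabilityMeasure 𝒟] (x : EuclideanSpace ℝ (Fin 3)) :
    gradient (expectedLoss (sepLoss H h g u) 𝒟) x =
      !₂[H * x 0, h * x 1, g (x 2) + ∫ s, u s ∂𝒟] := by
  rw [expectedLoss_sepLoss]
  exact (hasGradientAt_sepLoss hg _ () x).gradient

theorem convexSmoothBoundedVariance_sepLoss (hg : SlopeBounds g μ H) (hμ : 0 ≤ μ) (hh : 0 ≤ h)
    (hhH : h ≤ H) (u : Ξ → ℝ) (𝒟 : Measure Ξ) [IsProbabilityMeasure 𝒟] {σ : ℝ}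
    (hσ : ∫ s, (u s - ∫ s', u s' ∂𝒟) ^ 2 ∂𝒟 ≤ σ ^ 2) :
    ConvexSmoothBoundedVariance (sepLoss H h g u) 𝒟 H σ where
  measurable _ := measurable_of_finite _
  integrable _ := Integrable.of_finite
  differentiable s x := (hasGradientAt_sepLoss hg u s x).differentiableAt
  twice_differentiable s := differentiable_stochGrad_sepLoss hg u s
  convex s := convexOn_sepLoss hg hμ (hh.trans hhH) hh u s
  smooth s := stochGrad_sepLoss_lipschitz hg hμ hh hhH u s
  variance_integrable _ := Integrable.of_finite
  variance_le x := by
    refine le_trans (le_of_eq ?_) hσ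
    congr 1
    funext s
    rw [stochGrad_sepLoss hg, gradient_expectedLoss_sepLoss hg, EuclideanSpace.norm_sq_eq]
    simp [Fin.sum_univ_three]

theorem globalLoss_sepLoss {M : ℕ} (hM : M ≠ 0) (u : Ξ → ℝ) (𝒟 : Fin M → ProbabilityMeasure Ξ)
    (hu : ∑ m, ∫ s, u s ∂(𝒟 m : Measure Ξ) = 0) (x : EuclideanSpace ℝ (Fin 3)) :
    globalLoss (sepLoss H h g u) 𝒟 x =
      H / 2 * x 0 ^ 2 + h / 2 * x 1 ^ 2 + ∫ t in (0 : ℝ)..x 2, g t := by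
  simp only [globalLoss, expectedLoss_sepLoss, sepLoss]
  rw [Finset.sum_add_distrib, ← Finset.sum_mul, hu]
  have : (M : ℝ) ≠ 0 := by exact_mod_cast hM
  simp
  field_simp

end sepLoss

/-! ### FedAvg acts coordinatewise -/

/-- `k` steps of scalar SGD with gradient `g` and additive gradient noise `n`. -/
def scalarSGD (g : ℝ → ℝ) (η : ℝ) (n : ℕ → ℝ) (x : ℝ) : ℕ → ℝ
  | 0 => x
  | k + 1 => scalarSGD g η n x k - η * (g (scalarSGD g η n x k) + n k)

/-- The server iterates of scalar FedAvg with gradient `g` and additive gradient noise `n`. -/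
def scalarServer {M : ℕ} (g : ℝ → ℝ) (η : ℝ) (K : ℕ) (n : ℕ → ℕ → Fin M → ℝ) (x₀ : ℝ) : ℕ → ℝ
  | 0 => x₀
  | r + 1 => (M : ℝ)⁻¹ * ∑ m, scalarSGD g η (fun k => n r k m) (scalarServer g η K n x₀ r) K

section iterates

variable {Ξ : Type*} {H h μ : ℝ} {g : ℝ → ℝ}

theorem localSGD_sepLoss (hg : SlopeBounds g μ H) (u : Ξ → ℝ) (η : ℝ) (s : ℕ → Ξ)
    (x : EuclideanSpace ℝ (Fin 3)) (k : ℕ) :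
    localSGD (sepLoss H h g u) η s x k = !₂[(1 - η * H) ^ k * x 0, (1 - η * h) ^ k * x 1,
      scalarSGD g η (fun k => u (s k)) (x 2) k] := by
  induction k with
  | zero => ext i; fin_cases i <;> simp [localSGD, scalarSGD]
  | succ k ih =>
    rw [localSGD, stochGrad_sepLoss hg, ih]
    ext i
    fin_cases i
    · simp; ring
    · simp; ring
    · simp [scalarSGD]

/-- The first two coordinates see no noise and agree on all clients, so averaging does not affect
them and they contract as in `K * r` plain gradient steps. -/
theorem serverIterate_sepLoss (hg : SlopeBounds g μ H) {M : ℕ} (hM : M ≠ 0) (u : Ξ → ℝ) (η : ℝ)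
    (K : ℕ) (s : ℕ → ℕ → Fin M → Ξ) (x : EuclideanSpace ℝ (Fin 3)) (r : ℕ) :
    serverIterate (sepLoss H h g u) η K s x r =
      !₂[(1 - η * H) ^ (K * r) * x 0, (1 - η * h) ^ (K * r) * x 1,
        scalarServer g η K (fun r k m => u (s r k m)) (x 2) r] := by
  have : (M : ℝ) ≠ 0 := by exact_mod_cast hM
  induction r with
  | zero => ext i; fin_cases i <;> simp [serverIterate, scalarServer]
  | succ r ih =>
    simp only [serverIterate, localSGD_sepLoss hg]
    rw [ih]
    ext i
    fin_cases i
    · simp [this, mul_add, pow_add]; ring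
    · simp [this, mul_add, pow_add]; ring
    · simp [scalarServer]

end iterates

/-! ### Calculus of bounded functions of independent noise -/

/-- `X` is bounded and measurable with respect to the `σ`-algebra of the `N i`, `i ∈ S`. -/
def BddOn {ι Ω : Type*} (N : ι → Ω → ℝ) (S : Set ι) (X : Ω → ℝ) : Prop :=
  Measurable[⨆ i ∈ S, MeasurableSpace.comap (N i) inferInstance] X ∧ ∃ C, ∀ ω, |X ω| ≤ C

/-- `N` is a family of independent bounded random variables. -/
structure IndepNoise {ι Ω : Type*} [MeasurableSpace Ω] (N : ι → Ω → ℝ) (P : Measure Ω) : Prop where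
  measurable : ∀ i, Measurable (N i)
  bounded : ∀ i, ∃ C, ∀ ω, |N i ω| ≤ C
  indep : iIndepFun N P

namespace BddOn

variable {ι Ω : Type*} {N : ι → Ω → ℝ} {S T : Set ι} {X Y : Ω → ℝ}

theorem const (c : ℝ) : BddOn N S (fun _ => c) := ⟨measurable_const, |c|, fun _ => le_rfl⟩

theorem add (hX : BddOn N S X) (hY : BddOn N S Y) : BddOn N S (fun ω => X ω + Y ω) := by
  obtain ⟨hX, A, hA⟩ := hX
  obtain ⟨hY, B, hB⟩ := hY
  exact ⟨hX.add hY, A + B, fun ω => (abs_add_le _ _).trans (add_le_add (hA ω) (hB ω))⟩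

theorem mul (hX : BddOn N S X) (hY : BddOn N S Y) : BddOn N S (fun ω => X ω * Y ω) := by
  obtain ⟨hX, A, hA⟩ := hX
  obtain ⟨hY, B, hB⟩ := hY
  refine ⟨hX.mul hY, A * B, fun ω => ?_⟩
  rw [abs_mul]
  exact mul_le_mul (hA ω) (hB ω) (abs_nonneg _) ((abs_nonneg _).trans (hA ω))

theorem const_mul (hX : BddOn N S X) (c : ℝ) : BddOn N S (fun ω => c * X ω) := (const c).mul hX

theorem sub (hX : BddOn N S X) (hY : BddOn N S Y) : BddOn N S (fun ω => X ω - Y ω) := by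
  simpa [sub_eq_add_neg] using hX.add (hY.const_mul (-1))

theorem pow (hX : BddOn N S X) (n : ℕ) : BddOn N S (fun ω => X ω ^ n) := by
  induction n with
  | zero => simpa using const 1
  | succ n ih => simpa [pow_succ] using ih.mul hX

theorem sum {κ : Type*} {F : κ → Ω → ℝ} (s : Finset κ) (hF : ∀ i, BddOn N S (F i)) :
    BddOn N S (fun ω => ∑ i ∈ s, F i ω) := by
  classical
  induction s using Finset.induction_on with
  | empty => simpa using const 0
  | insert i s hi ih => simpa [Finset.sum_insert hi] using (hF i).add ih

theorem comp_continuous (hX : BddOn N S X) {g : ℝ → ℝ} (hg : Continuous g) :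
    BddOn N S (fun ω => g (X ω)) := by
  obtain ⟨hX, A, hA⟩ := hX
  obtain ⟨C, hC⟩ := (isCompact_Icc (a := -A) (b := A)).exists_bound_of_continuousOn hg.continuousOn
  exact ⟨hg.measurable.comp hX, C, fun ω => hC _ (abs_le.1 (hA ω))⟩

theorem indicator_pos (hX : BddOn N S X) : BddOn N S (fun ω => if 0 < X ω then 1 else 0) := by
  refine ⟨Measurable.ite (measurableSet_lt measurable_const hX.1) measurable_const
    measurable_const, 1, fun ω => ?_⟩
  dsimp only
  split_ifs <;> simp

theorem mono (hX : BddOn N S X) (hST : S ⊆ T) : BddOn N T X :=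
  ⟨hX.1.mono (biSup_mono hST) le_rfl, hX.2⟩

variable [MeasurableSpace Ω] {P : Measure Ω}

theorem self (hN : IndepNoise N P) {i : ι} (hi : i ∈ S) : BddOn N S (N i) :=
  ⟨(comap_measurable (N i)).mono
    (le_biSup (fun i => MeasurableSpace.comap (N i) inferInstance) hi) le_rfl, hN.bounded i⟩

theorem measurable (hX : BddOn N S X) (hN : IndepNoise N P) : Measurable X :=
  hX.1.mono (iSup₂_le fun i _ => (hN.measurable i).comap_le) le_rfl

theorem integrable [IsFiniteMeasure P] (hX : BddOn N S X) (hN : IndepNoise N P) :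
    Integrable X P := by
  obtain ⟨C, hC⟩ := hX.2
  exact Integrable.of_bound (hX.measurable hN).aestronglyMeasurable C (.of_forall hC)

/-- Functions of disjoint blocks of an independent family are independent. -/
theorem integral_mul (hX : BddOn N S X) (hY : BddOn N T Y) (hN : IndepNoise N P)
    (hST : Disjoint S T) : ∫ ω, X ω * Y ω ∂P = (∫ ω, X ω ∂P) * ∫ ω, Y ω ∂P := by
  have hI := indep_iSup_of_disjoint (fun i => (hN.measurable i).comap_le) hN.indep.iIndep hST
  have : IndepFun X Y P := by
    rw [IndepFun_iff_Indep]
    exact indep_of_indep_of_le_right (indep_of_indep_of_le_left hI hX.1.comap_le) hY.1.comap_le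
  exact this.integral_mul_eq_mul_integral (hX.measurable hN).aestronglyMeasurable
    (hY.measurable hN).aestronglyMeasurable

theorem sq_integral_le [IsProbabilityMeasure P] (hX : BddOn N S X) (hN : IndepNoise N P) :
    (∫ ω, X ω ∂P) ^ 2 ≤ ∫ ω, X ω ^ 2 ∂P := by
  set m := ∫ ω, X ω ∂P
  have hi := (hX.integrable hN).const_mul (2 * m)
  have hi' : Integrable (fun ω => 2 * m * X ω - m ^ 2) P := hi.sub (integrable_const _)
  have := integral_mono hi' ((hX.pow 2).integrable hN)
    fun ω => (by nlinarith [sq_nonneg (X ω - m)] : 2 * m * X ω - m ^ 2 ≤ X ω ^ 2)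
  rw [integral_sub hi (integrable_const _), integral_const_mul] at this
  simp only [integral_const, probReal_univ, one_smul] at this
  nlinarith

end BddOn

/-! ### One client: comparison with linear recursions and drift -/

/-- The response of a linear recursion with factor `ρ` and step size `η` to the noise `n`. -/
def linearResponse (ρ η : ℝ) (n : ℕ → ℝ) : ℕ → ℝ
  | 0 => 0
  | k + 1 => ρ * linearResponse ρ η n k - η * n k

/-- A step with the linear gradient `a * y` is monotone when `1 - η * a ≥ 0`, and replacing `g` by
this larger gradient only lowers the iterate. -/
theorem le_scalarSGD {g : ℝ → ℝ} {a η : ℝ} (hg : ∀ y, g y ≤ a * y) (hη : 0 ≤ η)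
    (ha : 0 ≤ 1 - η * a) (n : ℕ → ℝ) (x : ℝ) (k : ℕ) :
    (1 - η * a) ^ k * x + linearResponse (1 - η * a) η n k ≤ scalarSGD g η n x k := by
  induction k with
  | zero => simp [linearResponse, scalarSGD]
  | succ k ih =>
    have h1 := mul_le_mul_of_nonneg_left ih ha
    have h2 := mul_le_mul_of_nonneg_left (hg (scalarSGD g η n x k)) hη
    rw [scalarSGD, linearResponse, pow_succ]
    nlinarith

section client

variable {ι Ω : Type*} [MeasurableSpace Ω] {P : Measure Ω}
  {N : ι → Ω → ℝ} {S : Set ι} {e : ℕ → ι} {X : Ω → ℝ} {g : ℝ → ℝ} {η : ℝ}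

theorem bddOn_scalarSGD (hN : IndepNoise N P) (hX : BddOn N S X) (hg : Continuous g) (k : ℕ) :
    BddOn N (S ∪ e '' Set.Iio k) (fun ω => scalarSGD g η (fun j => N (e j) ω) (X ω) k) := by
  induction k with
  | zero => exact hX.mono Set.subset_union_left
  | succ k ih =>
    have h1 := ih.mono (Set.union_subset_union_right S
      (Set.image_mono (Set.Iio_subset_Iio k.le_succ)))
    have h2 : BddOn N (S ∪ e '' Set.Iio (k + 1)) (N (e k)) :=
      BddOn.self hN (.inr ⟨k, Nat.lt_succ_self k, rfl⟩)
    exact h1.sub (((h1.comp_continuous hg).add h2).const_mul η)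

theorem bddOn_linearResponse (hN : IndepNoise N P) (ρ η : ℝ) (k : ℕ) :
    BddOn N (e '' Set.Iio k) (fun ω => linearResponse ρ η (fun j => N (e j) ω) k) := by
  induction k with
  | zero => exact BddOn.const 0
  | succ k ih =>
    have h1 := ih.mono (Set.image_mono (f := e) (Set.Iio_subset_Iio k.le_succ))
    have h2 : BddOn N (e '' Set.Iio (k + 1)) (N (e k)) :=
      BddOn.self hN ⟨k, Nat.lt_succ_self k, rfl⟩
    exact (h1.const_mul ρ).sub (h2.const_mul η)

theorem disjoint_past (he : Function.Injective e) (heS : ∀ k, e k ∉ S) (k : ℕ) :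
    Disjoint (S ∪ e '' Set.Iio k) {e k} := by
  rw [Set.disjoint_singleton_right]
  rintro (h | ⟨j, hj, hjk⟩)
  · exact heS k h
  · exact (he hjk ▸ hj : k < k).false

variable [IsProbabilityMeasure P]

/-- The weight `W` depends only on noise used before step `k`. Later noise is independent of it and
enters only through its mean, so the comparison slope `c` may be chosen separately on an event
decided by that time. -/
theorem scalarSGD_weighted_le (hN : IndepNoise N P) (he : Function.Injective e)
    (heS : ∀ k, e k ∉ S) (hX : BddOn N S X) (hg : Continuous g) {c ν : ℝ}
    (hgc : ∀ y, g y ≤ c * y) (hη : 0 ≤ η) (hc : 0 ≤ 1 - η * c) (hν : ∀ k, ∫ ω, N (e k) ω ∂P = ν)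
    {W : Ω → ℝ} {k : ℕ} (hW : BddOn N (S ∪ e '' Set.Iio k) W) (hW0 : ∀ ω, 0 ≤ W ω) (n : ℕ) :
    (1 - η * c) ^ n * (∫ ω, scalarSGD g η (fun j => N (e j) ω) (X ω) k * W ω ∂P)
        - η * ν * (∫ ω, W ω ∂P) * ∑ j ∈ Finset.range n, (1 - η * c) ^ j
      ≤ ∫ ω, scalarSGD g η (fun j => N (e j) ω) (X ω) (k + n) * W ω ∂P := by
  induction n with
  | zero => simp
  | succ n ih =>
    set Y := fun n ω => scalarSGD g η (fun j => N (e j) ω) (X ω) n with hY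
    have hb : BddOn N (S ∪ e '' Set.Iio (k + n)) (Y (k + n)) := bddOn_scalarSGD hN hX hg _
    have hW' : BddOn N (S ∪ e '' Set.Iio (k + n)) W :=
      hW.mono (Set.union_subset_union_right S (Set.image_mono (Set.Iio_subset_Iio (by omega))))
    have hn : BddOn N {e (k + n)} (N (e (k + n))) := BddOn.self hN rfl
    have h1 := hW'.integral_mul hn hN (disjoint_past he heS (k + n))
    rw [hν] at h1
    have i1 : Integrable (fun ω => Y (k + n) ω * W ω) P := (hb.mul hW').integrable hN
    have i2 : Integrable (fun ω => W ω * N (e (k + n)) ω) P :=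
      ((hW'.mono (Set.subset_univ _)).mul (hn.mono (Set.subset_univ _))).integrable hN
    have h2 : ∫ ω, ((1 - η * c) * (Y (k + n) ω * W ω) - η * (W ω * N (e (k + n)) ω)) ∂P
        ≤ ∫ ω, Y (k + n + 1) ω * W ω ∂P := by
      refine integral_mono ((i1.const_mul _).sub (i2.const_mul _))
        (((bddOn_scalarSGD hN hX hg _).mul (hW.mono (Set.union_subset_union_right S
          (Set.image_mono (Set.Iio_subset_Iio (by omega)))))).integrable hN) fun ω => ?_
      have h3 := mul_le_mul_of_nonneg_left (hgc (Y (k + n) ω)) (mul_nonneg hη (hW0 ω))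
      simp only [hY, scalarSGD] at h3 ⊢
      nlinarith
    rw [integral_sub (i1.const_mul _) (i2.const_mul _), integral_const_mul, integral_const_mul,
      h1] at h2
    refine le_trans ?_ h2
    have h4 := mul_le_mul_of_nonneg_left ih hc
    rw [Finset.sum_range_succ', pow_succ]
    simp only [pow_succ, pow_zero, ← Finset.sum_mul]
    nlinarith

theorem scalarSGD_integral_le (hN : IndepNoise N P) (he : Function.Injective e)
    (heS : ∀ k, e k ∉ S) (hX : BddOn N S X) (hg : Continuous g) {c ν : ℝ}
    (hgc : ∀ y, g y ≤ c * y) (hη : 0 ≤ η) (hc : 0 ≤ 1 - η * c) (hν : ∀ k, ∫ ω, N (e k) ω ∂P = ν)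
    (n : ℕ) :
    (1 - η * c) ^ n * (∫ ω, X ω ∂P) - η * ν * ∑ j ∈ Finset.range n, (1 - η * c) ^ j
      ≤ ∫ ω, scalarSGD g η (fun j => N (e j) ω) (X ω) n ∂P := by
  simpa [scalarSGD] using
    scalarSGD_weighted_le hN he heS hX hg hgc hη hc hν (BddOn.const 1) (fun _ => zero_le_one)
      (k := 0) n

/-- The noise has constant square, so its cube is `σ ^ 2` times itself and all mixed terms odd in
the newest noise vanish. The fourth moment then obeys a recursion that preserves the Gaussian bound
with constant 3. -/
theorem integral_linearResponse_moments (hN : IndepNoise N P) (he : Function.Injective e) {σ : ℝ}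
    (hmean : ∀ k, ∫ ω, N (e k) ω ∂P = 0) (hsq : ∀ k ω, N (e k) ω ^ 2 = σ ^ 2) (ρ : ℝ) (k : ℕ) :
    (∫ ω, linearResponse ρ η (fun j => N (e j) ω) k ∂P = 0) ∧
    (∫ ω, linearResponse ρ η (fun j => N (e j) ω) k ^ 2 ∂P
      = η ^ 2 * σ ^ 2 * ∑ j ∈ Finset.range k, (ρ ^ 2) ^ j) ∧
    ∫ ω, linearResponse ρ η (fun j => N (e j) ω) k ^ 4 ∂P
      ≤ 3 * (∫ ω, linearResponse ρ η (fun j => N (e j) ω) k ^ 2 ∂P) ^ 2 := by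
  induction k with
  | zero => simp [linearResponse]
  | succ k ih =>
    obtain ⟨m1, m2, m4⟩ := ih
    have hb := bddOn_linearResponse (e := e) hN ρ η k
    set Z := fun ω => linearResponse ρ η (fun j => N (e j) ω) k
    have hn : BddOn N {e k} (N (e k)) := BddOn.self hN rfl
    have hd : Disjoint (e '' Set.Iio k) {e k} := by
      simpa using disjoint_past (S := ∅) he (fun _ => id) k
    have hz : ∀ p : ℕ, ∫ ω, Z ω ^ p * N (e k) ω ∂P = 0 := fun p => by
      rw [(hb.pow p).integral_mul hn hN hd, hmean, mul_zero]
    have ib : ∀ p : ℕ, Integrable (fun ω => Z ω ^ p) P := fun p => (hb.pow p).integrable hN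
    have iz : ∀ p : ℕ, Integrable (fun ω => Z ω ^ p * N (e k) ω) P := fun p =>
      (((hb.pow p).mono (Set.subset_univ _)).mul (hn.mono (Set.subset_univ _))).integrable hN
    have e2 : ∫ ω, linearResponse ρ η (fun j => N (e j) ω) (k + 1) ^ 2 ∂P
        = ρ ^ 2 * ∫ ω, Z ω ^ 2 ∂P + η ^ 2 * σ ^ 2 := by
      have : ∀ ω, linearResponse ρ η (fun j => N (e j) ω) (k + 1) ^ 2
          = ρ ^ 2 * Z ω ^ 2 + (-2 * ρ * η) * (Z ω ^ 1 * N (e k) ω) + η ^ 2 * σ ^ 2 := fun ω => by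
        simp only [linearResponse, Z]
        linear_combination η ^ 2 * hsq k ω
      simp_rw [this]
      rw [integral_add (((ib 2).const_mul _).fun_add ((iz 1).const_mul _)) (integrable_const _),
        integral_add ((ib 2).const_mul _) ((iz 1).const_mul _), integral_const_mul,
        integral_const_mul, hz]
      simp
    have e4 : ∫ ω, linearResponse ρ η (fun j => N (e j) ω) (k + 1) ^ 4 ∂P
        = ρ ^ 4 * ∫ ω, Z ω ^ 4 ∂P + 6 * ρ ^ 2 * η ^ 2 * σ ^ 2 * ∫ ω, Z ω ^ 2 ∂P
          + η ^ 4 * σ ^ 4 := by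
      have : ∀ ω, linearResponse ρ η (fun j => N (e j) ω) (k + 1) ^ 4
          = ρ ^ 4 * Z ω ^ 4 + 6 * ρ ^ 2 * η ^ 2 * σ ^ 2 * Z ω ^ 2
            + (-4 * ρ ^ 3 * η) * (Z ω ^ 3 * N (e k) ω)
            + (-4 * ρ * η ^ 3 * σ ^ 2) * (Z ω ^ 1 * N (e k) ω) + η ^ 4 * σ ^ 4 := fun ω => by
        simp only [linearResponse, Z]
        linear_combination (6 * ρ ^ 2 * η ^ 2 * Z ω ^ 2 - 4 * ρ * η ^ 3 * Z ω * N (e k) ω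
          + η ^ 4 * (N (e k) ω ^ 2 + σ ^ 2)) * hsq k ω
      simp_rw [this]
      rw [integral_add (((((ib 4).const_mul _).fun_add ((ib 2).const_mul _)).fun_add
          ((iz 3).const_mul _)).fun_add ((iz 1).const_mul _)) (integrable_const _),
        integral_add ((((ib 4).const_mul _).fun_add ((ib 2).const_mul _)).fun_add
          ((iz 3).const_mul _)) ((iz 1).const_mul _),
        integral_add (((ib 4).const_mul _).fun_add ((ib 2).const_mul _)) ((iz 3).const_mul _),
        integral_add ((ib 4).const_mul _) ((ib 2).const_mul _)]
      simp only [integral_const_mul, hz]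
      simp
    refine ⟨?_, ?_, ?_⟩
    · have h1 := ib 1
      have h2 := iz 0
      have h3 := hz 0
      simp only [pow_one, pow_zero, one_mul] at h1 h2 h3
      simp only [linearResponse]
      rw [integral_sub (h1.const_mul _) (h2.const_mul _), integral_const_mul, integral_const_mul,
        h3, m1]
      simp
    · rw [e2, m2, Finset.sum_range_succ']
      simp only [pow_succ (ρ ^ 2), pow_zero, ← Finset.sum_mul]
      ring
    · rw [e4, e2]
      have hv : 0 ≤ ∫ ω, Z ω ^ 2 ∂P := integral_nonneg fun _ => sq_nonneg _
      have := mul_le_mul_of_nonneg_left m4 (by positivity : 0 ≤ ρ ^ 4)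
      have h5 : 0 ≤ η ^ 4 * σ ^ 4 := by positivity
      change _ ≤ 3 * (ρ ^ 2 * (∫ ω, Z ω ^ 2 ∂P) + η ^ 2 * σ ^ 2) ^ 2
      nlinarith

theorem integral_mul_indicator_pos_ge (hN : IndepNoise N P) {Z : Ω → ℝ} (hZ : BddOn N S Z)
    (h1 : ∫ ω, Z ω ∂P = 0) {s : ℝ} (hs : 0 < s) (h2 : ∫ ω, Z ω ^ 2 ∂P = s ^ 2)
    (h4 : ∫ ω, Z ω ^ 4 ∂P ≤ 3 * (∫ ω, Z ω ^ 2 ∂P) ^ 2) :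
    s / 4 ≤ ∫ ω, Z ω * (if 0 < Z ω then 1 else 0) ∂P := by
  -- A quartic minorant of the positive part of `Z`: half of `|y|` lies above the even part of this
  -- polynomial, with tangency at `|y| = 3 * s / 2`. Its mean is at least `s / 2 - 2 * s / 9 = 5 * s
  -- / 18`.
  have key : ∫ ω, (1 / 2 * Z ω + (1 / (2 * s)) * Z ω ^ 2 - 2 / (27 * s ^ 3) * Z ω ^ 4) ∂P
      ≤ ∫ ω, Z ω * (if 0 < Z ω then 1 else 0) ∂P := by
    refine integral_mono (((hZ.const_mul _).add ((hZ.pow 2).const_mul _)).sub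
      ((hZ.pow 4).const_mul _) |>.integrable hN) ((hZ.mul hZ.indicator_pos).integrable hN)
      fun ω => ?_
    have h : ∀ y : ℝ, 0 ≤ y → (1 / (2 * s)) * y ^ 2 - 2 / (27 * s ^ 3) * y ^ 4 ≤ y / 2 := by
      intro y hy
      have e : y / 2 - ((1 / (2 * s)) * y ^ 2 - 2 / (27 * s ^ 3) * y ^ 4)
          = y * (2 * y + 6 * s) * (2 * y - 3 * s) ^ 2 / (108 * s ^ 3) := by
        field_simp
        ring
      have : 0 ≤ y * (2 * y + 6 * s) * (2 * y - 3 * s) ^ 2 / (108 * s ^ 3) := by positivity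
      linarith
    dsimp only
    split_ifs with hz
    · linarith [h (Z ω) hz.le]
    · have := h (-Z ω) (by linarith)
      rw [neg_sq, Even.neg_pow (by decide)] at this
      linarith
  refine le_trans ?_ key
  have j1 := hZ.integrable hN
  have j2 := (hZ.pow 2).integrable hN
  have j4 := (hZ.pow 4).integrable hN
  rw [integral_sub ((j1.const_mul _).fun_add (j2.const_mul _)) (j4.const_mul _),
    integral_add (j1.const_mul _) (j2.const_mul _), integral_const_mul, integral_const_mul,
    integral_const_mul, h1, h2]
  rw [h2] at h4
  have h5 := mul_le_mul_of_nonneg_left h4 (by positivity : 0 ≤ 2 / (27 * s ^ 3))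
  have e1 : 2 / (27 * s ^ 3) * (3 * (s ^ 2) ^ 2) = 2 / 9 * s := by field_simp; ring
  have e2 : 1 / (2 * s) * s ^ 2 = s / 2 := by field_simp
  rw [e1] at h5
  rw [e2]
  linarith

/-- Local SGD with centred noise drifts in the direction in which the gradient is flatter. -/
theorem scalarSGD_drift (hN : IndepNoise N P) (he : Function.Injective e) (heS : ∀ k, e k ∉ S)
    (hX : BddOn N S X) (hX0 : 0 ≤ ∫ ω, X ω ∂P) (hg : Continuous g) {a b σ s : ℝ}
    (hga : ∀ y, g y ≤ a * y) (hgb : ∀ y, g y ≤ b * y) (hba : b ≤ a) (hη : 0 ≤ η)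
    (ha : 0 ≤ 1 - η * a) (hmean : ∀ k, ∫ ω, N (e k) ω ∂P = 0)
    (hsq : ∀ k ω, N (e k) ω ^ 2 = σ ^ 2) (n J : ℕ) (hs : 0 < s)
    (hs2 : s ^ 2 = η ^ 2 * σ ^ 2 * ∑ j ∈ Finset.range n, ((1 - η * a) ^ 2) ^ j) :
    (1 - η * a) ^ (n + J) * (∫ ω, X ω ∂P) + ((1 - η * b) ^ J - (1 - η * a) ^ J) * (s / 4)
      ≤ ∫ ω, scalarSGD g η (fun j => N (e j) ω) (X ω) (n + J) ∂P := by
  have hab : 1 - η * a ≤ 1 - η * b := by nlinarith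
  have hb : 0 ≤ 1 - η * b := ha.trans hab
  obtain ⟨m1, m2, m4⟩ := integral_linearResponse_moments (η := η) hN he hmean hsq (1 - η * a) n
  have hZ := bddOn_linearResponse (e := e) hN (1 - η * a) η n
  set Z := fun ω => linearResponse (1 - η * a) η (fun j => N (e j) ω) n
  have hpos := integral_mul_indicator_pos_ge hN hZ m1 hs (m2.trans hs2.symm) m4
  have hW := hZ.indicator_pos
  set W : Ω → ℝ := fun ω => if 0 < Z ω then 1 else 0 with hWdef
  have hW0 : ∀ ω, 0 ≤ W ω := fun ω => by simp only [hWdef]; split_ifs <;> norm_num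
  have hW1 : ∀ ω, 0 ≤ 1 - W ω := fun ω => by simp only [hWdef]; split_ifs <;> norm_num
  have hWS : BddOn N (S ∪ e '' Set.Iio n) W := hW.mono Set.subset_union_right
  have hWc : BddOn N (S ∪ e '' Set.Iio n) (fun ω => 1 - W ω) := (BddOn.const 1).sub hWS
  -- After `n` steps of building up spread, the last `J` steps are compared with the flat slope `b`
  -- where `Z > 0` and with the steep slope `a` elsewhere.
  have s1 := scalarSGD_weighted_le hN he heS hX hg hgb hη hb hmean hWS hW0 J
  have s2 := scalarSGD_weighted_le hN he heS hX hg hga hη ha hmean hWc hW1 J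
  have s3 := scalarSGD_integral_le hN he heS hX hg hga hη ha hmean n
  have hYn := bddOn_scalarSGD (e := e) (η := η) hN hX hg n
  have hYK := bddOn_scalarSGD (e := e) (η := η) hN hX hg (n + J)
  set Yn := fun ω => scalarSGD g η (fun j => N (e j) ω) (X ω) n
  set YK := fun ω => scalarSGD g η (fun j => N (e j) ω) (X ω) (n + J)
  have split : ∀ Y : Ω → ℝ, BddOn N Set.univ Y →
      ∫ ω, Y ω * (1 - W ω) ∂P = ∫ ω, Y ω ∂P - ∫ ω, Y ω * W ω ∂P := fun Y hY => by
    rw [← integral_sub (hY.integrable hN) ((hY.mul (hW.mono (Set.subset_univ _))).integrable hN)]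
    congr 1
    funext ω
    ring
  change _ ≤ ∫ ω, YK ω * (1 - W ω) ∂P at s2
  change _ ≤ ∫ ω, YK ω * W ω ∂P at s1
  rw [split YK (hYK.mono (Set.subset_univ _))] at s2
  have split' := split Yn (hYn.mono (Set.subset_univ _))
  simp only [Yn] at split'
  rw [split'] at s2
  -- `X` comes from noise outside the current run, so it is independent of the sign of `Z`; with
  -- nonnegative mean it cannot reduce the gain.
  have hXW : ∫ ω, X ω * W ω ∂P = (∫ ω, X ω ∂P) * ∫ ω, W ω ∂P := by
    refine hX.integral_mul hW hN ?_
    rw [Set.disjoint_right]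
    rintro _ ⟨j, _, rfl⟩
    exact heS j
  have iXW : Integrable (fun ω => X ω * W ω) P :=
    ((hX.mono (Set.subset_univ _)).mul (hW.mono (Set.subset_univ _))).integrable hN
  have iZW : Integrable (fun ω => Z ω * W ω) P := (hZ.mul hW).integrable hN
  have s4 : ∫ ω, ((1 - η * a) ^ n * (X ω * W ω) + Z ω * W ω) ∂P ≤ ∫ ω, Yn ω * W ω ∂P := by
    refine integral_mono ((iXW.const_mul _).add iZW) ((hYn.mul hWS).integrable hN) fun ω => ?_
    have := mul_le_mul_of_nonneg_right
      (le_scalarSGD hga hη ha (fun j => N (e j) ω) (X ω) n) (hW0 ω)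
    simp only [Yn, Z] at this ⊢
    linarith
  rw [integral_add (iXW.const_mul _) iZW, integral_const_mul, hXW] at s4
  have hWi : 0 ≤ ∫ ω, W ω ∂P := integral_nonneg hW0
  have s5 : s / 4 ≤ ∫ ω, Yn ω * W ω ∂P := by
    have : 0 ≤ (1 - η * a) ^ n * ((∫ ω, X ω ∂P) * ∫ ω, W ω ∂P) := by positivity
    linarith
  have s6 := mul_le_mul_of_nonneg_left s5 (sub_nonneg.2 (pow_le_pow_left₀ ha hab J))
  have s7 := mul_le_mul_of_nonneg_left s3 (pow_nonneg ha J)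
  rw [pow_add]
  simp only [Yn] at s6
  nlinarith

end client

/-! ### Server iterates as functions of past rounds -/

section server

variable {Ω : Type*} [MeasurableSpace Ω] {P : Measure Ω} {M : ℕ} {N : ℕ × ℕ × Fin M → Ω → ℝ}
  {g : ℝ → ℝ}

theorem injective_sampleIndex (r : ℕ) (m : Fin M) :
    Function.Injective (fun k : ℕ => (r, k, m)) := fun j k h => by simpa using h

theorem bddOn_scalarServer (hN : IndepNoise N P) (hg : Continuous g) (η : ℝ) (K : ℕ) (x₀ : ℝ)
    (r : ℕ) :
    BddOn N {i | i.1 < r}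
      (fun ω => scalarServer g η K (fun r k m => N (r, k, m) ω) x₀ r) := by
  induction r with
  | zero => exact BddOn.const x₀
  | succ r ih =>
    refine (BddOn.sum _ fun m => ?_).const_mul _
    refine (bddOn_scalarSGD (e := fun k => (r, k, m)) hN ih hg K).mono ?_
    rintro _ (h | ⟨k, _, rfl⟩)
    · exact Nat.lt_succ_of_lt h
    · exact Nat.lt_succ_self r

theorem integral_scalarServer_succ [IsProbabilityMeasure P] (hN : IndepNoise N P)
    (hg : Continuous g) (η : ℝ) (K : ℕ) (x₀ : ℝ) (r : ℕ) :
    ∫ ω, scalarServer g η K (fun r k m => N (r, k, m) ω) x₀ (r + 1) ∂P =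
      (M : ℝ)⁻¹ * ∑ m, ∫ ω, scalarSGD g η (fun k => N (r, k, m) ω)
        (scalarServer g η K (fun r k m => N (r, k, m) ω) x₀ r) K ∂P := by
  simp only [scalarServer]
  rw [integral_const_mul, integral_finsetSum]
  exact fun m _ => (bddOn_scalarSGD (e := fun k => (r, k, m)) hN
    (bddOn_scalarServer hN hg η K x₀ r) hg K).integrable hN

end server

/-! ### Reduction to the scalar coordinate -/

/-- Hard instances from `sepLoss`: the first two coordinates confine the step size, so that only the
scalar iterates in the last coordinate have to be bounded. -/
theorem hardInstance_sepLoss.{u} {K R M : ℕ} {H D σ ζ h μ y₀ z v : ℝ} {g : ℝ → ℝ} {Ξ : Type}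
    [MeasurableSpace Ξ] [Finite Ξ] [MeasurableSingletonClass Ξ] (u : Ξ → ℝ)
    (𝒟 : Fin M → ProbabilityMeasure Ξ) (hM : M ≠ 0) (hD : 0 < D) (hh : 0 ≤ h)
    (hhH : h ≤ H) (hμ : 0 ≤ μ) (hg : SlopeBounds g μ H) (hz : g z = 0) (hy : |y₀ - z| ≤ D / 4)
    (hvar : ∀ m, ∫ s, (u s - ∫ s', u s' ∂(𝒟 m : Measure Ξ)) ^ 2 ∂(𝒟 m : Measure Ξ) ≤ σ ^ 2)
    (hsum : ∑ m, ∫ s, u s ∂(𝒟 m : Measure Ξ) = 0)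
    (hhet : (M : ℝ)⁻¹ * ∑ m, (∫ s, u s ∂(𝒟 m : Measure Ξ)) ^ 2 ≤ ζ ^ 2)
    (hsame : ζ = 0 → ∀ m m', 𝒟 m = 𝒟 m') (hv : v ≤ h * D ^ 2 / 128)
    (hX : ∀ (η : ℝ) (Ω : Type u) (_ : MeasurableSpace Ω) (P : Measure Ω)
      (_ : IsProbabilityMeasure P) (N : ℕ × ℕ × Fin M → Ω → ℝ), IndepNoise N P →
      (∀ i ω, N i ω ∈ Set.range u) → (∀ i, ∫ ω, N i ω ∂P = ∫ s, u s ∂(𝒟 i.2.2 : Measure Ξ)) →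
      0 ≤ η → η * H ≤ 2 → 1 ≤ 2 * (K * R * (η * h)) →
      v ≤ μ / 2 *
        ∫ ω, (scalarServer g η K (fun r k m => N (r, k, m) ω) y₀ R - z) ^ 2 ∂P) :
    HardInstance.{u} K R M H D σ ζ v := by
  have hH : 0 ≤ H := hh.trans hhH
  refine ⟨3, Ξ, inferInstance, sepLoss H h g u, 𝒟, !₂[0, 0, z], !₂[D / 4, D / 4, y₀],
    fun m => convexSmoothBoundedVariance_sepLoss hg hμ hh hhH u _ (hvar m), fun x => ?_, ?_, hsame,
    ?_, ?_⟩
  · rw [globalLoss_sepLoss hM u 𝒟 hsum, globalLoss_sepLoss hM u 𝒟 hsum]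
    have h1 := hg.integral_quadratic_growth hz (x 2)
    have h2 : 0 ≤ μ / 2 * (x 2 - z) ^ 2 := by positivity
    have h3 : 0 ≤ H / 2 * x 0 ^ 2 := by positivity
    have h4 : 0 ≤ h / 2 * x 1 ^ 2 := by positivity
    simp
    linarith
  · refine le_trans (le_of_eq ?_) hhet
    congr 2
    funext m
    rw [gradient_expectedLoss_sepLoss hg, EuclideanSpace.norm_sq_eq]
    simp [Fin.sum_univ_three, hz]
  · refine lt_of_pow_lt_pow_left₀ 2 hD.le ?_
    rw [EuclideanSpace.norm_sq_eq]
    have : (y₀ - z) ^ 2 ≤ (D / 4) ^ 2 := sq_le_sq' (by linarith [(abs_le.1 hy).1]) (abs_le.1 hy).2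
    simp [Fin.sum_univ_three]
    nlinarith
  · intro η Ω _ P _ ξ hξ
    set N : ℕ × ℕ × Fin M → Ω → ℝ := fun i ω => u (ξ i.1 i.2.1 i.2.2 ω) with hNdef
    have hu : Measurable u := measurable_of_finite u
    have hN : IndepNoise N P := by
      refine ⟨fun i => hu.comp (hξ.measurable _ _ _), fun i => ?_,
        hξ.indep.comp (fun _ => u) fun _ => hu⟩
      obtain ⟨C, hC⟩ := (Set.finite_range fun s => |u s|).bddAbove
      exact ⟨C, fun ω => hC ⟨_, rfl⟩⟩
    have hmean : ∀ i, ∫ ω, N i ω ∂P = ∫ s, u s ∂(𝒟 i.2.2 : Measure Ξ) := fun i => by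
      rw [← hξ.law i.1 i.2.1 i.2.2, integral_map (hξ.measurable _ _ _).aemeasurable
        hu.aestronglyMeasurable]
    have hb := bddOn_scalarServer hN hg.differentiable.continuous η K y₀ R
    set X := fun ω => scalarServer g η K (fun r k m => N (r, k, m) ω) y₀ R with hXdef
    have hL : ∀ ω, globalLoss (sepLoss H h g u) 𝒟 (serverIterate (sepLoss H h g u) η K
        (fun r k m => ξ r k m ω) !₂[D / 4, D / 4, y₀] R) =
        H / 2 * ((1 - η * H) ^ (K * R) * (D / 4)) ^ 2
          + h / 2 * ((1 - η * h) ^ (K * R) * (D / 4)) ^ 2 + ∫ t in (0 : ℝ)..X ω, g t := fun ω => by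
      rw [serverIterate_sepLoss hg hM, globalLoss_sepLoss hM u 𝒟 hsum]
      simp [hXdef, hNdef]
    have hL' : globalLoss (sepLoss H h g u) 𝒟 !₂[0, 0, z] = ∫ t in (0 : ℝ)..z, g t := by
      rw [globalLoss_sepLoss hM u 𝒟 hsum]
      simp
    simp only [hL, hL']
    have hψ : Integrable (fun ω => ∫ t in (0 : ℝ)..X ω, g t) P :=
      (hb.comp_continuous hg.continuous_integral).integrable hN
    refine ⟨(integrable_const _).add hψ, ?_⟩
    rw [integral_add (integrable_const _) hψ, integral_const]
    have hsq : Integrable (fun ω => (X ω - z) ^ 2) P :=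
      ((hb.sub (BddOn.const z)).pow 2).integrable hN
    have hgrow : μ / 2 * ∫ ω, (X ω - z) ^ 2 ∂P
        ≤ (∫ ω, (∫ t in (0 : ℝ)..X ω, g t) ∂P) - ∫ t in (0 : ℝ)..z, g t := by
      have hi : Integrable (fun ω => (∫ t in (0 : ℝ)..X ω, g t) - ∫ t in (0 : ℝ)..z, g t) P :=
        hψ.sub (integrable_const _)
      have := integral_mono (hsq.const_mul (μ / 2)) hi
        fun ω => hg.integral_quadratic_growth hz (X ω)
      rw [integral_const_mul, integral_sub hψ (integrable_const _), integral_const] at this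
      simpa using this
    have hvar0 : 0 ≤ μ / 2 * ∫ ω, (X ω - z) ^ 2 ∂P :=
      mul_nonneg (by positivity) (integral_nonneg fun _ => sq_nonneg _)
    have hA : 0 ≤ H / 2 * ((1 - η * H) ^ (K * R) * (D / 4)) ^ 2 := by positivity
    have hB : 0 ≤ h / 2 * ((1 - η * h) ^ (K * R) * (D / 4)) ^ 2 := by positivity
    simp only [probReal_univ, one_smul]
    -- Outside this range `|1 - η * H| ≥ 1`, so coordinate 0 never gets closer to its minimizer than
    -- its start `D / 4`.
    by_cases hη : 0 ≤ η ∧ η * H ≤ 2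
    -- If this fails, Bernoulli's inequality keeps coordinate 1 at `D / 8` or more, which costs `h *
    -- D ^ 2 / 128`.
    · by_cases hη2 : 1 ≤ 2 * (K * R * (η * h))
      · have := hX η Ω _ P ‹_› N hN (fun i ω => ⟨_, rfl⟩) hmean hη.1 hη.2 hη2
        linarith
      · have h0 : 0 ≤ η * h := mul_nonneg hη.1 hh
        have h1 : η * h ≤ 2 := (mul_le_mul_of_nonneg_left hhH hη.1).trans hη.2
        have h2 : 1 / 2 ≤ (1 - η * h) ^ (K * R) := by
          have := one_add_mul_le_pow (a := -(η * h)) (by linarith) (K * R)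
          rw [← sub_eq_add_neg] at this
          push_cast at this
          nlinarith
        have h3 : (D / 8) ^ 2 ≤ ((1 - η * h) ^ (K * R) * (D / 4)) ^ 2 :=
          pow_le_pow_left₀ (by positivity) (by nlinarith) 2
        have := mul_le_mul_of_nonneg_left h3 (by positivity : 0 ≤ h / 2)
        linarith
    · have h1 : 1 ≤ (1 - η * H) ^ 2 := by
        rw [not_and_or, not_le, not_le] at hη
        rcases hη with hη | hη
        · nlinarith [mul_nonpos_of_nonpos_of_nonneg hη.le hH]
        · nlinarith
      have h2 : (D / 4) ^ 2 ≤ ((1 - η * H) ^ (K * R) * (D / 4)) ^ 2 := by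
        rw [mul_pow, ← pow_mul, mul_comm (K * R), pow_mul]
        exact le_mul_of_one_le_left (sq_nonneg _) (one_le_pow₀ h1)
      have := mul_le_mul_of_nonneg_left h2 (by positivity : 0 ≤ H / 2)
      nlinarith [mul_le_mul_of_nonneg_right hhH (sq_nonneg D), mul_nonneg hh (sq_nonneg D)]

/-! ### Elementary power inequalities and accumulation of drift -/

theorem one_sub_pow_le_half {t : ℝ} {n : ℕ} (h0 : 0 ≤ t) (h1 : t ≤ 1) (hn : 1 ≤ n * t) :
    (1 - t) ^ n ≤ 1 / 2 := by
  have h2 := one_add_mul_le_pow (a := t) (by linarith) n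
  have h3 : (1 - t) ^ n * (1 + t) ^ n ≤ 1 := by
    rw [← mul_pow]
    exact pow_le_one₀ (mul_nonneg (by linarith) (by linarith)) (by nlinarith)
  have h4 : 0 ≤ (1 - t) ^ n := pow_nonneg (by linarith) n
  nlinarith

theorem half_le_one_sub_pow {t : ℝ} {n : ℕ} (h1 : t ≤ 1) (hn : n * t ≤ 1 / 2) :
    1 / 2 ≤ (1 - t) ^ n := by
  have h2 := one_add_mul_le_pow (a := -t) (by linarith) n
  rw [← sub_eq_add_neg] at h2
  linarith

/-- The tangent-line bound for the power at `x`, with `x ^ (n - 1)` weakened to `x ^ n` because `x ≤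
1`. -/
theorem mul_pow_mul_sub_le_pow_sub_pow {x y : ℝ} (hx : 0 ≤ x) (hx1 : x ≤ 1) (hxy : x ≤ y) (n : ℕ) :
    n * x ^ n * (y - x) ≤ y ^ n - x ^ n := by
  induction n with
  | zero => simp
  | succ n ih =>
    have h1 := mul_le_mul_of_nonneg_left ih (hx.trans hxy)
    have h2 : 0 ≤ x ^ n := pow_nonneg hx n
    have h3 : 0 ≤ n * x ^ n * (y - x) * (y - x) := by
      have := sub_nonneg.2 hxy
      positivity
    have h4 : 0 ≤ x ^ n * (1 - x) * (y - x) :=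
      mul_nonneg (mul_nonneg h2 (sub_nonneg.2 hx1)) (sub_nonneg.2 hxy)
    push_cast
    rw [pow_succ, pow_succ]
    nlinarith

/-- `J` is the smaller of `K / 2` and `1 / (2 * t)`, rounded down: contraction with factor `1 - t`
loses at most half over `J` steps, while `J` is either a fixed fraction of the round or already of
the order of the relaxation time. -/
theorem exists_block_length {K : ℕ} (hK : 2 ≤ K) {t : ℝ} (h0 : 0 < t) (h1 : t ≤ 1 / 2) :
    ∃ J : ℕ, 1 ≤ J ∧ 2 * J ≤ K ∧ J * t ≤ 1 / 2 ∧ ((K : ℝ) ≤ 4 * J ∨ 1 / 4 ≤ J * t) := by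
  have h2 : (1 : ℝ) ≤ 1 / (2 * t) := by rw [le_div_iff₀ (by positivity)]; linarith
  have hf : 1 ≤ ⌊1 / (2 * t)⌋₊ := Nat.le_floor (by simpa using h2)
  have hle := Nat.floor_le (by positivity : 0 ≤ 1 / (2 * t))
  have hlt := Nat.lt_floor_add_one (1 / (2 * t))
  rw [le_div_iff₀ (by positivity)] at hle
  rw [div_lt_iff₀ (by positivity)] at hlt
  have hf' : (1 : ℝ) ≤ ⌊1 / (2 * t)⌋₊ := by exact_mod_cast hf
  rcases le_total (K / 2) ⌊1 / (2 * t)⌋₊ with h | h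
  · refine ⟨K / 2, by omega, by omega, ?_, .inl ?_⟩
    · have : ((K / 2 : ℕ) : ℝ) ≤ ⌊1 / (2 * t)⌋₊ := by exact_mod_cast h
      nlinarith
    · have : K ≤ 4 * (K / 2) := by omega
      exact_mod_cast this
  · exact ⟨⌊1 / (2 * t)⌋₊, hf, by omega, by linarith, .inr (by nlinarith)⟩

/-- A contraction with factor `(1 - t) ^ K` and drift `β` accumulates the drift over `R` rounds. -/
theorem drift_le_of_recursion {K R J : ℕ} {t β : ℝ} {x : ℕ → ℝ} (h0 : 0 ≤ t) (h1 : t ≤ 1)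
    (hKR : 1 ≤ K * R * t) (hJ : (K : ℝ) ≤ 4 * J ∨ 1 / 4 ≤ J * t) (hβ : 0 ≤ β) (hx0 : x 0 = 0)
    (hx : ∀ r, 0 ≤ x r → (1 - t) ^ K * x r + β ≤ x (r + 1)) : β ≤ 8 * (J * t) * x R := by
  have hp0 : 0 ≤ (1 - t) ^ K := pow_nonneg (by linarith) K
  have hsum : ∀ r, β * ∑ i ∈ Finset.range r, ((1 - t) ^ K) ^ i ≤ x r := fun r => by
    induction r with
    | zero => simp [hx0]
    | succ r ih =>
      have h2 : 0 ≤ β * ∑ i ∈ Finset.range r, ((1 - t) ^ K) ^ i := by positivity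
      have h3 := mul_le_mul_of_nonneg_left ih hp0
      have h4 := hx r (h2.trans ih)
      rw [Finset.sum_range_succ']
      simp only [pow_succ ((1 - t) ^ K), pow_zero, ← Finset.sum_mul]
      nlinarith
  have h5 : (1 - t) ^ (K * R) ≤ 1 / 2 := one_sub_pow_le_half h0 h1 (by exact_mod_cast hKR)
  rw [pow_mul] at h5
  have h6 := mul_neg_geom_sum ((1 - t) ^ K) R
  -- The loss per round is at most both `K * t` and 1; each alternative for `J` makes one of these
  -- at most `4 * J * t`.
  have h7 : 1 - (1 - t) ^ K ≤ 4 * (J * t) := by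
    rcases hJ with hJ | hJ
    · have h2 := one_add_mul_le_pow (a := -t) (by linarith) K
      rw [← sub_eq_add_neg] at h2
      nlinarith
    · linarith
  have h8 : 0 ≤ x R := le_trans (by positivity) (hsum R)
  have h9 : 0 ≤ 1 - (1 - t) ^ K := sub_nonneg.2 (pow_le_one₀ (by linarith) (by linarith))
  have h10 := mul_le_mul_of_nonneg_right (hsum R) h9
  have h11 := mul_le_mul_of_nonneg_left h7 h8
  have h12 : β * (∑ i ∈ Finset.range R, ((1 - t) ^ K) ^ i) * (1 - (1 - t) ^ K)
      = β * (1 - ((1 - t) ^ K) ^ R) := by rw [← h6]; ring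
  nlinarith

/-! ### The asymmetric objective -/

/-- The derivative of a smooth convex function with curvature close to `H / 4` on the left and to
`H / 16` on the right. -/
def asymGrad (H δ : ℝ) (x : ℝ) : ℝ := H / 32 * (5 * x - 3 * √(x ^ 2 + 16 * δ ^ 2))

theorem abs_sqrt_sub_sqrt_le {x y e : ℝ} (he : 0 ≤ e) (hxy : x ≤ y) :
    |√(y ^ 2 + e) - √(x ^ 2 + e)| ≤ y - x := by
  have h : ∀ a b : ℝ, √(b ^ 2 + e) ≤ √(a ^ 2 + e) + |b - a| := fun a b => by
    rw [Real.sqrt_le_left (by positivity)]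
    have h1 := Real.sq_sqrt (by positivity : 0 ≤ a ^ 2 + e)
    have h2 : |a| ≤ √(a ^ 2 + e) := Real.abs_le_sqrt (by linarith)
    have h3 : a * (b - a) ≤ |a| * |b - a| := by rw [← abs_mul]; exact le_abs_self _
    have h4 := mul_le_mul_of_nonneg_right h2 (abs_nonneg (b - a))
    nlinarith [sq_abs (b - a)]
  have h1 := h x y
  have h2 := h y x
  rw [abs_of_nonneg (by linarith)] at h1
  rw [abs_sub_comm, abs_of_nonneg (by linarith)] at h2
  exact abs_le.2 ⟨by linarith, by linarith⟩

theorem slopeBounds_asymGrad {H δ : ℝ} (hH : 0 ≤ H) (hδ : 0 < δ) :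
    SlopeBounds (asymGrad H δ) (H / 16) H where
  differentiable := by
    have : ∀ x : ℝ, x ^ 2 + 16 * δ ^ 2 ≠ 0 := fun x => by positivity
    unfold asymGrad
    fun_prop (disch := assumption)
  lower x y hxy := by
    have := (abs_le.1 (abs_sqrt_sub_sqrt_le (by positivity : 0 ≤ 16 * δ ^ 2) hxy)).2
    have := mul_le_mul_of_nonneg_left this hH
    unfold asymGrad
    linarith
  upper x y hxy := by
    have := (abs_le.1 (abs_sqrt_sub_sqrt_le (by positivity : 0 ≤ 16 * δ ^ 2) hxy)).1
    have := mul_le_mul_of_nonneg_left this hH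
    have := mul_nonneg hH (sub_nonneg.2 hxy)
    unfold asymGrad
    linarith

/-- The square root dominates `|x|`, so smoothing the kink only lowers the gradient. The price is
that the minimizer moves from 0 to `3 * δ`. -/
theorem asymGrad_le {H δ : ℝ} (hH : 0 ≤ H) (x : ℝ) :
    asymGrad H δ x ≤ H / 4 * x ∧ asymGrad H δ x ≤ H / 16 * x := by
  have h := abs_le.1 (Real.abs_le_sqrt (by nlinarith : x ^ 2 ≤ x ^ 2 + 16 * δ ^ 2))
  have h1 := mul_le_mul_of_nonneg_left h.1 hH
  have h2 := mul_le_mul_of_nonneg_left h.2 hH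
  unfold asymGrad
  constructor <;> linarith

theorem asymGrad_eq_zero {H δ : ℝ} (hδ : 0 ≤ δ) : asymGrad H δ (3 * δ) = 0 := by
  have : √((3 * δ) ^ 2 + 16 * δ ^ 2) = 5 * δ := by
    rw [show (3 * δ) ^ 2 + 16 * δ ^ 2 = (5 * δ) ^ 2 by ring, Real.sqrt_sq (by positivity)]
  rw [asymGrad, this]
  ring

/-- Hard instances from `asymGrad`: it suffices that the mean of the last coordinate drifts far from
the minimizer. -/
theorem hardInstance_asymGrad.{u} {K R M : ℕ} {H D σ ζ h : ℝ} {Ξ : Type}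
    [MeasurableSpace Ξ] [Finite Ξ] [MeasurableSingletonClass Ξ] (u : Ξ → ℝ)
    (𝒟 : Fin M → ProbabilityMeasure Ξ) (hK : 2 ≤ K) (hM : M ≠ 0) (hD : 0 < D) (hh : 0 < h)
    (hhH : 8 * h ≤ H)
    (hvar : ∀ m, ∫ s, (u s - ∫ s', u s' ∂(𝒟 m : Measure Ξ)) ^ 2 ∂(𝒟 m : Measure Ξ) ≤ σ ^ 2)
    (hsum : ∑ m, ∫ s, u s ∂(𝒟 m : Measure Ξ) = 0)
    (hhet : (M : ℝ)⁻¹ * ∑ m, (∫ s, u s ∂(𝒟 m : Measure Ξ)) ^ 2 ≤ ζ ^ 2)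
    (hsame : ζ = 0 → ∀ m m', 𝒟 m = 𝒟 m')
    (hX : ∀ (g : ℝ → ℝ) (η : ℝ) (J : ℕ) (Ω : Type u) (_ : MeasurableSpace Ω) (P : Measure Ω)
      (_ : IsProbabilityMeasure P) (N : ℕ × ℕ × Fin M → Ω → ℝ), Continuous g →
      (∀ y, g y ≤ H / 4 * y) → (∀ y, g y ≤ H / 16 * y) → IndepNoise N P →
      (∀ i ω, N i ω ∈ Set.range u) → (∀ i, ∫ ω, N i ω ∂P = ∫ s, u s ∂(𝒟 i.2.2 : Measure Ξ)) →
      0 < η → η * (H / 4) ≤ 1 / 2 → 1 ≤ 2 * (K * R * (η * h)) →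
      1 ≤ J → 2 * J ≤ K → J * (η * (H / 4)) ≤ 1 / 2 →
      ((K : ℝ) ≤ 4 * J ∨ 1 / 4 ≤ J * (η * (H / 4))) →
      ∃ β q : ℝ, 0 ≤ q ∧ 8 * h * D ^ 2 ≤ H * q ^ 2 ∧ (J * (η * (H / 4))) * q / 16 ≤ β ∧
        ∀ r, 0 ≤ ∫ ω, scalarServer g η K (fun r k m => N (r, k, m) ω) 0 r ∂P →
          (1 - η * (H / 4)) ^ K * (∫ ω, scalarServer g η K (fun r k m => N (r, k, m) ω) 0 r ∂P) + β
            ≤ ∫ ω, scalarServer g η K (fun r k m => N (r, k, m) ω) 0 (r + 1) ∂P) :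
    HardInstance.{u} K R M H D σ ζ (h * D ^ 2 / 2 ^ 19) := by
  have hH : 0 < H := by linarith
  -- At distance of order `D * w` from the minimizer the curvature `H / 16` costs a loss of order `H
  -- * (D * w) ^ 2 = h * D ^ 2`.
  set w := √(h / H) with hw
  have hw0 : 0 < w := Real.sqrt_pos.2 (by positivity)
  have hw2 : H * w ^ 2 = h := by rw [hw, Real.sq_sqrt (by positivity)]; field_simp
  have hw1 : w ≤ 1 := by
    rw [hw, ← Real.sqrt_one]
    exact Real.sqrt_le_sqrt ((div_le_one hH).2 (by linarith))
  -- This puts the minimizer `3 * δ` at `D * w / 128`, half of the lower bound `q / 128 ≥ 2 * D * w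
  -- / 128` for the mean iterate obtained below.
  have hδ : 0 < D * w / 384 := by positivity
  have hg := slopeBounds_asymGrad hH.le hδ
  have hwD : D * w ≤ D := mul_le_of_le_one_right hD.le hw1
  refine hardInstance_sepLoss (y₀ := 0) u 𝒟 hM hD hh.le (by linarith) (by positivity) hg
    (asymGrad_eq_zero hδ.le) ?_ hvar hsum hhet hsame ?_ ?_
  · rw [zero_sub, abs_neg, abs_of_nonneg (by positivity)]
    linarith
  · have : 0 ≤ h * D ^ 2 := by positivity
    norm_num
    linarith
  · intro η Ω _ P _ N hN hNu hmean hη0 hηH hηh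
    have hη : 0 < η := by
      rcases hη0.eq_or_lt with rfl | hη
      · norm_num at hηh
      · exact hη
    have ht0 : 0 < η * (H / 4) := by positivity
    have ht1 : η * (H / 4) ≤ 1 / 2 := by linarith
    obtain ⟨J, hJ1, hJK, hJt, hJ⟩ := exists_block_length hK ht0 ht1
    obtain ⟨β, q, hq, hqh, hβ, hrec⟩ := hX _ η J Ω _ P ‹_› N hg.differentiable.continuous
      (fun y => (asymGrad_le hH.le y).1) (fun y => (asymGrad_le hH.le y).2) hN hNu hmean hη ht1 hηh
      hJ1 hJK hJt hJ
    have hJ0 : (0 : ℝ) < J := by exact_mod_cast hJ1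
    have hKR : 1 ≤ K * R * (η * (H / 4)) := by
      have : (K * R : ℝ) * (η * (8 * h)) ≤ K * R * (η * H) := by gcongr
      linarith
    have hdrift := drift_le_of_recursion
      (x := fun r => ∫ ω, scalarServer (asymGrad H (D * w / 384)) η K
        (fun r k m => N (r, k, m) ω) 0 r ∂P) ht0.le (by linarith) hKR hJ
      (le_trans (by positivity) hβ) (by simp [scalarServer]) hrec
    have hb := bddOn_scalarServer hN hg.differentiable.continuous η K 0 R
    set X := fun ω => scalarServer (asymGrad H (D * w / 384)) η K (fun r k m => N (r, k, m) ω) 0 R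
    have hqX : q / 128 ≤ ∫ ω, X ω ∂P := by
      have h1 := hβ.trans hdrift
      have h2 : (J * (η * (H / 4))) * (q / 128) ≤ (J * (η * (H / 4))) * ∫ ω, X ω ∂P := by
        simp only [X]
        linarith
      exact le_of_mul_le_mul_left h2 (by positivity)
    have hqw : 2 * (D * w) ≤ q := by
      refine le_of_sq_le_sq ?_ hq
      have : H * (2 * (D * w)) ^ 2 ≤ H * q ^ 2 := by nlinarith
      exact le_of_mul_le_mul_left this hH
    set m := ∫ ω, X ω ∂P
    have hm : D * w / 128 ≤ m - 3 * (D * w / 384) := by linarith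
    have hsq : (m - 3 * (D * w / 384)) ^ 2 ≤ ∫ ω, (X ω - 3 * (D * w / 384)) ^ 2 ∂P := by
      have hY := hb.sub (BddOn.const (3 * (D * w / 384)))
      have hi : ∫ ω, (X ω - 3 * (D * w / 384)) ∂P = m - 3 * (D * w / 384) := by
        rw [integral_sub (hb.integrable hN) (integrable_const _)]
        simp [m]
      rw [← hi]
      exact hY.sq_integral_le hN
    have h1 : (D * w / 128) ^ 2 ≤ (m - 3 * (D * w / 384)) ^ 2 :=
      pow_le_pow_left₀ (by positivity) hm 2
    have h2 := mul_le_mul_of_nonneg_left (h1.trans hsq) (by positivity : 0 ≤ H / 16 / 2)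
    refine le_trans (le_of_eq ?_) h2
    rw [← hw2]
    ring

theorem slopeBounds_linear {c H : ℝ} (hc : c ≤ H) : SlopeBounds (fun x => c * x) c H where
  differentiable := by fun_prop
  lower x y _ := by rw [mul_sub]
  upper x y hxy := by
    rw [← mul_sub]
    exact mul_le_mul_of_nonneg_right hc (sub_nonneg.2 hxy)

/-! ### The deterministic and variance terms -/

/-- A badly conditioned deterministic quadratic. -/
theorem hardInstance_quadratic.{u} {K R M : ℕ} {H D σ ζ : ℝ} (hK : 1 ≤ K) (hR : 1 ≤ R)
    (hM : M ≠ 0) (hH : 0 < H) (hD : 0 < D) :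
    HardInstance.{u} K R M H D σ ζ (H * D ^ 2 / (K * R) / 1024) := by
  have hK' : (1 : ℝ) ≤ K := by exact_mod_cast hK
  have hR' : (1 : ℝ) ≤ R := by exact_mod_cast hR
  have hKR : (1 : ℝ) ≤ K * R := one_le_mul_of_one_le_of_one_le hK' hR'
  have hg := slopeBounds_linear hH.le
  -- With this `h` the window is empty: `2 * K * R * η * h = η * H / 4 ≤ 1 / 2`.
  refine hardInstance_sepLoss (Ξ := Unit) (h := H / (8 * (K * R))) (y₀ := 0) (fun _ => 0)
    (fun _ => ⟨Measure.dirac (), inferInstance⟩) hM hD (by positivity) ?_ le_rfl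
    hg (mul_zero 0) (by simpa using by positivity) (fun _ => by simpa using sq_nonneg σ)
    (by simp) (by simpa using sq_nonneg ζ) (fun _ _ _ => rfl)
    (le_of_eq (by field_simp; norm_num)) ?_
  · exact div_le_self hH.le (by linarith)
  · intro η Ω _ P _ N _ _ _ _ hηH hη
    have : 2 * (K * R * (η * (H / (8 * (K * R))))) = η * H / 4 := by field_simp; ring
    linarith

/-- The uniform distribution on `Bool`. -/
def fairCoin : ProbabilityMeasure Bool :=
  ⟨(2⁻¹ : ENNReal) • Measure.dirac true + (2⁻¹ : ENNReal) • Measure.dirac false,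
    ⟨by simp [ENNReal.inv_two_add_inv_two]⟩⟩

theorem integral_fairCoin (φ : Bool → ℝ) :
    ∫ b, φ b ∂(fairCoin : Measure Bool) = (φ true + φ false) / 2 := by
  change ∫ b, φ b ∂((2⁻¹ : ENNReal) • Measure.dirac true + (2⁻¹ : ENNReal) • Measure.dirac false) = _
  rw [integral_add_measure (Integrable.of_finite.smul_measure (by simp))
    (Integrable.of_finite.smul_measure (by simp)), integral_smul_measure,
    integral_smul_measure, integral_dirac, integral_dirac]
  simp
  ring

/-- The Rademacher noise `±σ`. -/
def signNoise (σ : ℝ) (b : Bool) : ℝ := if b then σ else -σ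

theorem integral_signNoise (σ : ℝ) : ∫ b, signNoise σ b ∂(fairCoin : Measure Bool) = 0 := by
  rw [integral_fairCoin]
  simp [signNoise]

theorem signNoise_sq (σ : ℝ) (b : Bool) : signNoise σ b ^ 2 = σ ^ 2 := by
  cases b <;> simp [signNoise]

theorem integral_signNoise_variance (σ : ℝ) :
    ∫ b, (signNoise σ b - ∫ b', signNoise σ b' ∂(fairCoin : Measure Bool)) ^ 2
      ∂(fairCoin : Measure Bool) ≤ σ ^ 2 := by
  simp only [integral_signNoise, sub_zero]
  rw [integral_fairCoin, signNoise_sq, signNoise_sq]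
  linarith

theorem integral_sum_sq {ι Ω : Type*} [MeasurableSpace Ω] {P : Measure Ω} [IsProbabilityMeasure P]
    {N : ι → Ω → ℝ} {M : ℕ} {e : Fin M → ι} {σ : ℝ} (hN : IndepNoise N P)
    (he : Function.Injective e) (hmean : ∀ m, ∫ ω, N (e m) ω ∂P = 0)
    (hsq : ∀ m ω, N (e m) ω ^ 2 = σ ^ 2) :
    ∫ ω, (∑ m, N (e m) ω) ^ 2 ∂P = M * σ ^ 2 := by
  have hb : ∀ m, BddOn N {e m} (N (e m)) := fun m => BddOn.self hN rfl
  have hi : ∀ m m', Integrable (fun ω => N (e m) ω * N (e m') ω) P := fun m m' =>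
    (((hb m).mono (Set.subset_univ _)).mul ((hb m').mono (Set.subset_univ _))).integrable hN
  have hv : ∀ m m', ∫ ω, N (e m) ω * N (e m') ω ∂P = if m = m' then σ ^ 2 else 0 := by
    intro m m'
    split_ifs with h
    · subst h
      simp [← pow_two, hsq]
    · rw [(hb m).integral_mul (hb m') hN (by simpa using fun h' => h (he h')), hmean, zero_mul]
  simp_rw [pow_two (∑ m, N (e m) _), Finset.sum_mul_sum]
  rw [integral_finsetSum _ fun m _ => integrable_finsetSum _ fun m' _ => hi m m']
  simp_rw [integral_finsetSum _ fun m' _ => hi _ m', hv]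
  simp

section variance

variable {Ω : Type*} [MeasurableSpace Ω] {P : Measure Ω} [IsProbabilityMeasure P] {M : ℕ}
  {N : ℕ × ℕ × Fin M → Ω → ℝ} {h η σ : ℝ}

/-- For a linear gradient the noise of all clients accumulates in the average iterate. -/
theorem sum_le_integral_scalarServer_sq (hN : IndepNoise N P) (hM : M ≠ 0)
    (hmean : ∀ i, ∫ ω, N i ω ∂P = 0) (hsq : ∀ i ω, N i ω ^ 2 = σ ^ 2) (K R : ℕ) (x₀ : ℝ) :
    η ^ 2 * (σ ^ 2 / M) * ∑ j ∈ Finset.range (R * K), ((1 - η * h) ^ 2) ^ j ≤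
      ∫ ω, scalarServer (fun x => h * x) η K (fun r k m => N (r, k, m) ω) x₀ R ^ 2 ∂P := by
  have hM' : (M : ℝ) ≠ 0 := by exact_mod_cast hM
  have hg : Continuous fun x : ℝ => h * x := by fun_prop
  set X := fun r ω => scalarServer (fun x => h * x) η K (fun r k m => N (r, k, m) ω) x₀ r
  -- Because the gradient is linear, the average over clients follows the same recursion at every
  -- local step, driven by averaged noise, so the variance recursion runs through all `R * K` steps.
  have hround : ∀ r k,
      η ^ 2 * (σ ^ 2 / M) * ∑ j ∈ Finset.range (r * K), ((1 - η * h) ^ 2) ^ j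
        ≤ ∫ ω, X r ω ^ 2 ∂P →
      η ^ 2 * (σ ^ 2 / M) * ∑ j ∈ Finset.range (r * K + k), ((1 - η * h) ^ 2) ^ j
        ≤ ∫ ω, ((M : ℝ)⁻¹ * ∑ m, scalarSGD (fun x => h * x) η (fun k => N (r, k, m) ω)
          (X r ω) k) ^ 2 ∂P := by
    intro r k hr
    induction k with
    | zero => simpa [scalarSGD, hM'] using hr
    | succ k ih =>
      set A := fun ω => (M : ℝ)⁻¹ * ∑ m, scalarSGD (fun x => h * x) η (fun k => N (r, k, m) ω)
          (X r ω) k with hAdef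
      set B := fun ω => ∑ m, N (r, k, m) ω with hBdef
      have hA : BddOn N {i | i.1 < r ∨ i.1 = r ∧ i.2.1 < k} A := by
        refine (BddOn.sum _ fun m => ?_).const_mul _
        refine (bddOn_scalarSGD (e := fun k => (r, k, m)) hN
          (bddOn_scalarServer hN hg η K x₀ r) hg k).mono ?_
        rintro _ (h | ⟨j, hj, rfl⟩)
        · exact .inl h
        · exact .inr ⟨rfl, hj⟩
      have hB : BddOn N {i | i.1 = r ∧ i.2.1 = k} B :=
        BddOn.sum _ fun m => BddOn.self hN ⟨rfl, rfl⟩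
      have hAB : ∫ ω, A ω * B ω ∂P = 0 := by
        rw [hA.integral_mul hB hN, integral_finsetSum]
        · simp [hmean]
        · exact fun m _ => (BddOn.self (S := Set.univ) hN trivial).integrable hN
        · rw [Set.disjoint_left]
          rintro i hi ⟨h1, h2⟩
          rcases hi with hi | ⟨_, hi⟩ <;> omega
      have hB2 : ∫ ω, B ω ^ 2 ∂P = M * σ ^ 2 :=
        integral_sum_sq (e := fun m => (r, k, m)) hN (fun m m' h => by simpa using h)
          (fun _ => hmean _) fun _ => hsq _
      have hstep : ∀ ω, ((M : ℝ)⁻¹ * ∑ m, scalarSGD (fun x => h * x) η (fun k => N (r, k, m) ω)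
          (X r ω) (k + 1)) ^ 2 = (1 - η * h) ^ 2 * A ω ^ 2
            + (-2 * (1 - η * h) * η * (M : ℝ)⁻¹) * (A ω * B ω)
            + η ^ 2 * ((M : ℝ)⁻¹) ^ 2 * B ω ^ 2 := by
        intro ω
        have : (M : ℝ)⁻¹ * ∑ m, scalarSGD (fun x => h * x) η (fun k => N (r, k, m) ω)
            (X r ω) (k + 1) = (1 - η * h) * A ω - η * ((M : ℝ)⁻¹ * B ω) := by
          simp only [hAdef, hBdef, scalarSGD, Finset.sum_sub_distrib, ← Finset.mul_sum,
            Finset.sum_add_distrib]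
          ring
        rw [this]
        ring
      have iA : Integrable (fun ω => A ω ^ 2) P := (hA.pow 2).integrable hN
      have iB : Integrable (fun ω => B ω ^ 2) P := (hB.pow 2).integrable hN
      have iAB : Integrable (fun ω => A ω * B ω) P :=
        ((hA.mono (Set.subset_univ _)).mul (hB.mono (Set.subset_univ _))).integrable hN
      simp_rw [hstep]
      rw [integral_add ((iA.const_mul _).fun_add (iAB.const_mul _)) (iB.const_mul _),
        integral_add (iA.const_mul _) (iAB.const_mul _), integral_const_mul, integral_const_mul,
        integral_const_mul, hAB, hB2, ← add_assoc, Finset.sum_range_succ']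
      simp only [pow_succ ((1 - η * h) ^ 2), pow_zero, ← Finset.sum_mul]
      have h1 := mul_le_mul_of_nonneg_left ih (sq_nonneg (1 - η * h))
      have h2 : η ^ 2 * ((M : ℝ)⁻¹) ^ 2 * (M * σ ^ 2) = η ^ 2 * (σ ^ 2 / M) := by field_simp
      rw [h2]
      linarith
  induction R with
  | zero => simpa using integral_nonneg fun _ => sq_nonneg _
  | succ R ih =>
    rw [add_mul, one_mul]
    exact hround R K ih

end variance

/-- For `a ≤ 1` the geometric sum is at least `1 / (4 * a)`; for `a ≥ 1` its first term suffices. -/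
theorem inv_le_sq_mul_geom_sum {a : ℝ} {n : ℕ} (ha0 : 0 ≤ a) (hn : 1 ≤ 2 * (n * a)) :
    1 / (8 * n) ≤ a ^ 2 * ∑ j ∈ Finset.range n, ((1 - a) ^ 2) ^ j := by
  have hn0 : n ≠ 0 := by rintro rfl; norm_num at hn
  have hn1 : (1 : ℝ) ≤ n := by exact_mod_cast Nat.one_le_iff_ne_zero.2 hn0
  rw [div_le_iff₀ (by positivity)]
  set S := ∑ j ∈ Finset.range n, ((1 - a) ^ 2) ^ j with hS
  have hS1 : 1 ≤ S := by
    have := Finset.single_le_sum (f := fun j => ((1 - a) ^ 2) ^ j) (fun j _ => by positivity)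
      (Finset.mem_range.2 (Nat.pos_of_ne_zero hn0))
    simpa using this
  rcases le_total a 1 with ha | ha
  · have h1 : (1 - a) ^ (2 * n) ≤ 1 / 2 :=
      one_sub_pow_le_half ha0 ha (by push_cast; linarith)
    have h2 := mul_neg_geom_sum ((1 - a) ^ 2) n
    rw [← hS, ← pow_mul] at h2
    have h3 : 1 / 4 ≤ a * S := by nlinarith [sq_nonneg a]
    have h4 := mul_le_mul_of_nonneg_left h3 (by positivity : 0 ≤ a * (8 * n))
    nlinarith
  · have h1 : 1 ≤ a ^ 2 := one_le_pow₀ ha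
    have h2 : 1 ≤ a ^ 2 * S := one_le_mul_of_one_le_of_one_le h1 hS1
    nlinarith

/-- A noisy quadratic: the variance of the averaged noise. -/
theorem hardInstance_variance.{u} {K R M : ℕ} {H D σ ζ h : ℝ} (hM : M ≠ 0) (hD : 0 < D)
    (hh : 0 < h) (hhH : h ≤ H) (hσ : h ^ 2 * D ^ 2 * (M * K * R) ≤ σ ^ 2) :
    HardInstance.{u} K R M H D σ ζ (h * D ^ 2 / 128) := by
  refine hardInstance_sepLoss (y₀ := 0) (signNoise σ) (fun _ => fairCoin) hM hD hh.le hhH hh.le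
    (slopeBounds_linear hhH) (mul_zero h) (by simpa using by positivity)
    (fun _ => integral_signNoise_variance σ) (by simp [integral_signNoise])
    (by simpa [integral_signNoise] using sq_nonneg ζ) (fun _ _ _ => rfl) le_rfl ?_
  intro η Ω _ P _ N hN hNu hmean hη0 _ hη
  have hM' : (0 : ℝ) < M := by exact_mod_cast Nat.pos_of_ne_zero hM
  have h1 := sum_le_integral_scalarServer_sq (h := h) (η := η) (σ := σ) hN hM
    (fun i => (hmean i).trans (integral_signNoise σ))
    (fun i ω => by obtain ⟨b, hb⟩ := hNu i ω; rw [← hb, signNoise_sq]) K R 0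
  have h2 := inv_le_sq_mul_geom_sum (a := η * h) (n := R * K) (mul_nonneg hη0 hh.le)
    (by push_cast; linarith)
  simp only [sub_zero]
  set V := ∫ ω, scalarServer (fun x => h * x) η K (fun r k m => N (r, k, m) ω) 0 R ^ 2 ∂P
  have hKR : (0 : ℝ) < K * R := by
    by_contra hneg
    nlinarith [mul_nonneg hη0 hh.le, (by positivity : (0 : ℝ) ≤ K * R)]
  have h3 : h ^ 2 * (D ^ 2 / 8) ≤ h ^ 2 * V := by
    have h4 := mul_le_mul_of_nonneg_left h1 (sq_nonneg h)
    have h5 := mul_le_mul_of_nonneg_left h2 (by positivity : 0 ≤ σ ^ 2 / M)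
    have h6 : h ^ 2 * (D ^ 2 / 8) ≤ σ ^ 2 / M * (1 / (8 * (R * K : ℕ))) := by
      push_cast
      rw [div_mul_div_comm, le_div_iff₀ (by nlinarith)]
      linarith
    nlinarith
  have h7 : D ^ 2 / 8 ≤ V := le_of_mul_le_mul_left h3 (by positivity)
  nlinarith

theorem le_inv_mul_sum {M : ℕ} (hM : M ≠ 0) {c : ℝ} {φ : Fin M → ℝ} (h : M * c ≤ ∑ m, φ m) :
    c ≤ (M : ℝ)⁻¹ * ∑ m, φ m := by
  have hM' : (0 : ℝ) < M := by exact_mod_cast Nat.pos_of_ne_zero hM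
  rw [inv_mul_eq_div, le_div_iff₀ hM']
  linarith

/-! ### The bias caused by gradient noise -/

/-- An asymmetric noisy objective: the bias of local SGD. -/
theorem hardInstance_noiseBias.{u} {K R M : ℕ} {H D σ ζ h : ℝ} (hK : 2 ≤ K) (hM : M ≠ 0)
    (hD : 0 < D) (hσ : 0 < σ) (hh : 0 < h) (hhH : 8 * h ≤ H)
    (h2 : (8 * h) ^ 2 * D ^ 2 * (K * R) ≤ σ ^ 2)
    (h3 : (8 * h) ^ 3 * D ^ 2 * (K * R ^ 2) ≤ H * σ ^ 2) :
    HardInstance.{u} K R M H D σ ζ (h * D ^ 2 / 2 ^ 19) := by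
  refine hardInstance_asymGrad (signNoise σ) (fun _ => fairCoin) hK hM hD hh hhH
    (fun _ => integral_signNoise_variance σ) (by simp [integral_signNoise])
    (by simpa [integral_signNoise] using sq_nonneg ζ) (fun _ _ _ => rfl) ?_
  intro g η J Ω _ P _ N hg hga hgb hN hNu hmean hη ht1 hηh hJ1 hJK hJt hJ
  have hH : 0 < H := by linarith
  have hJ0 : (0 : ℝ) < J := by exact_mod_cast hJ1
  set t := η * (H / 4) with ht
  have ht0 : 0 < t := by positivity
  have hρJ : 1 / 2 ≤ (1 - t) ^ J := half_le_one_sub_pow (by linarith) hJt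
  -- The variance of the linear response after the first `K - J` steps. Since `K - J ≥ J`, it
  -- contains `J` terms that are each at least `1 / 4`.
  set v := η ^ 2 * σ ^ 2 * ∑ j ∈ Finset.range (K - J), ((1 - t) ^ 2) ^ j with hv
  have hsum : (J : ℝ) / 4 ≤ ∑ j ∈ Finset.range (K - J), ((1 - t) ^ 2) ^ j := by
    have h5 : ∑ j ∈ Finset.range J, ((1 - t) ^ 2) ^ j
        ≤ ∑ j ∈ Finset.range (K - J), ((1 - t) ^ 2) ^ j :=
      Finset.sum_le_sum_of_subset_of_nonneg (Finset.range_subset_range.2 (by omega))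
        fun _ _ _ => by positivity
    have h6 : ∀ j ∈ Finset.range J, 1 / 4 ≤ ((1 - t) ^ 2) ^ j := fun j hj => by
      have h7 : (1 - t) ^ J ≤ (1 - t) ^ j :=
        pow_le_pow_of_le_one (by linarith) (by linarith) (Finset.mem_range.1 hj).le
      rw [← pow_mul, mul_comm, pow_mul]
      nlinarith
    have h8 := Finset.card_nsmul_le_sum _ _ _ h6
    simp only [Finset.card_range, nsmul_eq_mul] at h8
    linarith
  have hsJ : 0 < √(J : ℝ) := Real.sqrt_pos.2 hJ0
  have hs : η * σ * √J / 2 ≤ √v := by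
    refine Real.le_sqrt_of_sq_le ?_
    have := mul_le_mul_of_nonneg_left hsum (by positivity : 0 ≤ η ^ 2 * σ ^ 2)
    rw [div_pow, mul_pow, mul_pow, Real.sq_sqrt hJ0.le]
    linarith
  have hs0 : 0 < √v := lt_of_lt_of_le (by positivity) hs
  have hs2 : √v ^ 2 = v := Real.sq_sqrt (Real.sqrt_pos.1 hs0).le
  have hpow := mul_pow_mul_sub_le_pow_sub_pow (x := 1 - t) (y := 1 - η * (H / 16)) (by linarith)
    (by linarith) (by linarith) J
  have hgap : 3 / 8 * (J * t) ≤ (1 - η * (H / 16)) ^ J - (1 - t) ^ J := by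
    have h5 : (1 - η * (H / 16)) - (1 - t) = 3 / 4 * t := by rw [ht]; ring
    rw [h5] at hpow
    have := mul_le_mul_of_nonneg_left hρJ (by positivity : 0 ≤ J * (3 / 4 * t))
    linarith
  refine ⟨((1 - η * (H / 16)) ^ J - (1 - t) ^ J) * (√v / 4), 3 / 4 * (η * σ * √J), by positivity,
    ?_, ?_, fun r hr => ?_⟩
  · rw [mul_pow, mul_pow, Real.sq_sqrt hJ0.le, mul_pow]
    -- If the block is a fraction of the round, `h3` and the square of the step size condition give
    -- this; if `J * t ≥ 1 / 4`, then `J * η * H ≥ 1` and `h2` suffices.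
    have key : 32 * h * D ^ 2 ≤ H * (η ^ 2 * σ ^ 2 * J) := by
      rcases hJ with hJ | hJ
      · have h5 := mul_le_mul_of_nonneg_left h3 (by positivity : 0 ≤ η ^ 2 * K / 4)
        have h6 := mul_le_mul_of_nonneg_left hJ (by positivity : 0 ≤ η ^ 2 * (H * σ ^ 2) / 4)
        have h7 : 1 ≤ (2 * (K * R * (η * h))) ^ 2 := one_le_pow₀ hηh
        have h8 := mul_le_mul_of_nonneg_left h7 (by positivity : 0 ≤ 32 * h * D ^ 2)
        linarith
      · have h5 := mul_le_mul_of_nonneg_left h2 hη.le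
        have h6 := mul_le_mul_of_nonneg_left hJ (by positivity : 0 ≤ 4 * η * σ ^ 2)
        have h8 := mul_le_mul_of_nonneg_left hηh (by positivity : 0 ≤ 32 * h * D ^ 2)
        rw [ht] at h6
        linarith
    have : 0 ≤ h * D ^ 2 := by positivity
    linarith
  · calc J * t * (3 / 4 * (η * σ * √J)) / 16 = 3 / 8 * (J * t) * (η * σ * √J / 2 / 4) := by ring
      _ ≤ _ := mul_le_mul hgap (by linarith) (by positivity) (le_trans (by positivity) hgap)
  · rw [integral_scalarServer_succ hN hg]
    refine le_inv_mul_sum hM ?_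
    rw [← nsmul_eq_mul, ← Fin.sum_const]
    refine Finset.sum_le_sum fun m _ => ?_
    have := scalarSGD_drift (e := fun k => (r, k, m)) hN (injective_sampleIndex r m)
      (fun k => by simp) (bddOn_scalarServer hN hg η K 0 r) hr hg hga hgb (by linarith) hη.le
      (by linarith) (fun k => (hmean _).trans (integral_signNoise σ))
      (fun k ω => by obtain ⟨b, hb⟩ := hNu (r, k, m) ω; rw [← hb, signNoise_sq]) (K - J) J hs0 hs2
    rw [Nat.sub_add_cancel (by omega)] at this
    exact this

/-! ### The client drift caused by heterogeneity -/

theorem exists_balanced_signs {M : ℕ} (hM : 2 ≤ M) : ∃ s : Fin M → ℝ,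
    (∀ m, s m = 1 ∨ s m = -1 ∨ s m = 0) ∧ ∑ m, s m = 0 ∧
      (M : ℝ) / 3 ≤ ∑ m, if s m = 1 then 1 else 0 := by
  -- Signs alternate, with a zero for the last client when `M` is odd; `M / 2` rounded down is at
  -- least a third of `M` since `M ≥ 2`.
  set f : ℕ → ℝ := fun i => if i < 2 * (M / 2) then (-1) ^ i else 0 with hf
  have hpairs : ∀ φ : ℝ → ℝ, ∀ q, ∑ i ∈ Finset.range (2 * q), φ ((-1) ^ i) = q * (φ 1 + φ (-1)) := by
    intro φ q
    induction q with
    | zero => simp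
    | succ q ih =>
      rw [mul_add, mul_one, Finset.sum_range_succ, Finset.sum_range_succ, ih, pow_succ, pow_mul]
      push_cast
      norm_num
      ring
  have hsum : ∀ φ : ℝ → ℝ, φ 0 = 0 → ∑ m : Fin M, φ (f m) = (M / 2 : ℕ) * (φ 1 + φ (-1)) := by
    intro φ h0
    rw [Fin.sum_univ_eq_sum_range (fun i => φ (f i)) M, ← hpairs φ (M / 2)]
    refine (Finset.sum_subset_zero_on_sdiff (Finset.range_subset_range.2 (by omega))
      (fun i hi => ?_) fun i hi => ?_).symm
    · simp only [Finset.mem_sdiff, Finset.mem_range] at hi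
      simp [hf, hi.2, h0]
    · simp only [Finset.mem_range] at hi
      simp [hf, hi]
  refine ⟨fun m => f m, fun m => ?_, ?_, ?_⟩
  · simp only [hf]
    split_ifs
    · rcases neg_one_pow_eq_or ℝ (m : ℕ) with h | h <;> simp [h]
    · simp
  · simpa using hsum id rfl
  · have h1 := hsum (fun x => if x = 1 then 1 else 0) (by norm_num)
    rw [if_pos rfl, if_neg (by norm_num), add_zero, mul_one] at h1
    rw [h1]
    have h2 : M ≤ 3 * (M / 2) := by omega
    have h3 : (M : ℝ) ≤ 3 * (M / 2 : ℕ) := by exact_mod_cast h2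
    linarith

/-- Only the indices `J ≤ j < 2 * J` are kept: there `(1 - t) ^ j ≥ 1 / 4`, and the two powers
differ by at least a constant times `J * t`. -/
theorem le_geom_sum_sub_geom_sum {K J : ℕ} {t : ℝ} (h0 : 0 ≤ t) (h1 : t ≤ 1 / 2)
    (hJK : 2 * J ≤ K) (hJ : J * t ≤ 1 / 2) :
    3 / 16 * (J * (J * t)) ≤
      ∑ j ∈ Finset.range K, (1 - t / 4) ^ j - ∑ j ∈ Finset.range K, (1 - t) ^ j := by
  have hρJ : 1 / 2 ≤ (1 - t) ^ J := half_le_one_sub_pow (by linarith) hJ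
  have hterm : ∀ j : ℕ, j * (1 - t) ^ j * (3 / 4 * t) ≤ (1 - t / 4) ^ j - (1 - t) ^ j := fun j => by
    have := mul_pow_mul_sub_le_pow_sub_pow (x := 1 - t) (y := 1 - t / 4) (by linarith)
      (by linarith) (by linarith) j
    rwa [show (1 - t / 4) - (1 - t) = 3 / 4 * t by ring] at this
  rw [← Finset.sum_sub_distrib]
  have hsub : ∑ j ∈ Finset.Ico J (2 * J), ((1 - t / 4) ^ j - (1 - t) ^ j)
      ≤ ∑ j ∈ Finset.range K, ((1 - t / 4) ^ j - (1 - t) ^ j) := by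
    refine Finset.sum_le_sum_of_subset_of_nonneg (fun j hj => ?_) fun j _ _ =>
      sub_nonneg.2 (pow_le_pow_left₀ (by linarith) (by linarith) j)
    rw [Finset.mem_Ico] at hj
    exact Finset.mem_range.2 (by omega)
  refine le_trans ?_ hsub
  have hle : ∀ j ∈ Finset.Ico J (2 * J), 3 / 16 * (J * t) ≤ (1 - t / 4) ^ j - (1 - t) ^ j := by
    intro j hj
    rw [Finset.mem_Ico] at hj
    refine le_trans ?_ (hterm j)
    have h2 : (1 - t) ^ (2 * J) ≤ (1 - t) ^ j :=
      pow_le_pow_of_le_one (by linarith) (by linarith) hj.2.le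
    have h3 : 1 / 4 ≤ (1 - t) ^ j := by
      rw [mul_comm, pow_mul] at h2
      nlinarith
    have h4 : (J : ℝ) ≤ j := by exact_mod_cast hj.1
    have h5 : (J : ℝ) * (1 / 4) ≤ j * (1 - t) ^ j :=
      mul_le_mul h4 h3 (by norm_num) (by positivity)
    have := mul_le_mul_of_nonneg_right h5 (by positivity : 0 ≤ 3 / 4 * t)
    linarith
  have := Finset.card_nsmul_le_sum _ _ _ hle
  rw [Nat.card_Ico, nsmul_eq_mul, show 2 * J - J = J by omega] at this
  linarith

/-- An asymmetric objective with clients pulling in opposite directions: the client drift. -/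
theorem hardInstance_heterogeneous.{u} {K R M : ℕ} {H D σ ζ h : ℝ} (hK : 2 ≤ K) (hM : 2 ≤ M)
    (hD : 0 < D) (hζ : 0 < ζ) (hh : 0 < h) (hhH : 8 * h ≤ H)
    (h2 : 8 * h * D ^ 2 * H ≤ ζ ^ 2) (h3 : (8 * h) ^ 3 * D ^ 2 * R ^ 2 ≤ H * ζ ^ 2) :
    HardInstance.{u} K R M H D σ ζ (h * D ^ 2 / 2 ^ 19) := by
  obtain ⟨s, hs, hs0, hs1⟩ := exists_balanced_signs hM
  have hM0 : M ≠ 0 := by omega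
  have hM' : (0 : ℝ) < M := by exact_mod_cast Nat.pos_of_ne_zero hM0
  refine hardInstance_asymGrad (Ξ := Fin M) (fun m => -(ζ * s m))
    (fun m => ⟨Measure.dirac m, inferInstance⟩) hK hM0 hD hh hhH
    (fun m => by simpa using sq_nonneg σ) ?_ ?_ (fun h => absurd h hζ.ne') ?_
  · simp [← Finset.mul_sum, hs0]
  · have h4 : ∀ m, (ζ * s m) ^ 2 ≤ ζ ^ 2 := fun m => by
      rcases hs m with h | h | h <;> rw [h] <;> nlinarith [sq_nonneg ζ]
    have h5 : ∑ m, (ζ * s m) ^ 2 ≤ M * ζ ^ 2 := by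
      rw [← nsmul_eq_mul, ← Fin.sum_const]
      exact Finset.sum_le_sum fun m _ => h4 m
    simp only [ProbabilityMeasure.coe_mk, integral_dirac, neg_sq]
    rw [inv_mul_eq_div, div_le_iff₀ hM']
    linarith
  intro g η J Ω _ P _ N hg hga hgb hN hNu hmean hη ht1 hηh hJ1 hJK hJt hJ
  simp only [ProbabilityMeasure.coe_mk, integral_dirac] at hmean
  have hH : 0 < H := by linarith
  have hJ0 : (0 : ℝ) < J := by exact_mod_cast hJ1
  have hb4 : η * (H / 16) = η * (H / 4) / 4 := by ring
  set t := η * (H / 4) with ht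
  have ht0 : 0 < t := by positivity
  have hG := le_geom_sum_sub_geom_sum ht0.le ht1 hJK hJt
  set A := ∑ j ∈ Finset.range K, (1 - t) ^ j
  set B := ∑ j ∈ Finset.range K, (1 - t / 4) ^ j
  have hAB : 0 ≤ B - A := le_trans (by positivity) hG
  -- The divisor 3 reflects that at least a third of the clients pull to the right.
  refine ⟨η * ζ * (B - A) / 3, η * ζ * J, by positivity, ?_, ?_, fun r hr => ?_⟩
  · rcases hJ with hJ | hJ
    · have h5 := mul_le_mul_of_nonneg_left h3 (by positivity : 0 ≤ (η * K) ^ 2 / 16)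
      have h6 : (K : ℝ) ^ 2 ≤ (4 * J) ^ 2 := pow_le_pow_left₀ (by positivity) hJ 2
      have h7 := mul_le_mul_of_nonneg_left h6 (by positivity : 0 ≤ H * (η * ζ) ^ 2 / 16)
      have h8 : 1 ≤ (2 * (K * R * (η * h))) ^ 2 := one_le_pow₀ hηh
      have h9 := mul_le_mul_of_nonneg_left h8 (by positivity : 0 ≤ 8 * h * D ^ 2)
      linarith
    · have h5 : 1 ≤ J * η * H := by rw [ht] at hJ; linarith
      have h6 : 1 ≤ (J * η * H) ^ 2 := one_le_pow₀ h5
      have h7 := mul_le_mul_of_nonneg_left h6 (sq_nonneg ζ)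
      have h8 : (8 * h * D ^ 2) * H ≤ (H * (η * ζ * J) ^ 2) * H := by linarith
      exact le_of_mul_le_mul_right h8 hH
  · have := mul_le_mul_of_nonneg_left hG (by positivity : 0 ≤ η * ζ / 3)
    linarith
  · rw [integral_scalarServer_succ hN hg]
    refine le_inv_mul_sum hM0 ?_
    set x := ∫ ω, scalarServer g η K (fun r k m => N (r, k, m) ω) 0 r ∂P
    have hX := bddOn_scalarServer hN hg η K 0 r
    -- Clients pulling right are compared with the flat slope, the others with the steep one. The
    -- terms `η * ζ * A * s m` cancel over the balanced signs, leaving the excess `B - A` of the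
    -- right-pulling clients.
    have hclient : ∀ m, (1 - t) ^ K * x + η * ζ * A * s m
        + η * ζ * (B - A) * (if s m = 1 then 1 else 0) ≤
        ∫ ω, scalarSGD g η (fun k => N (r, k, m) ω)
          (scalarServer g η K (fun r k m => N (r, k, m) ω) 0 r) K ∂P := fun m => by
      have hlow := scalarSGD_integral_le (e := fun k => (r, k, m)) hN (injective_sampleIndex r m)
        (fun k => by simp) hX hg hga hη.le (by linarith) (ν := -(ζ * s m))
        (fun k => hmean (r, k, m)) K
      have hhigh := scalarSGD_integral_le (e := fun k => (r, k, m)) hN (injective_sampleIndex r m)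
        (fun k => by simp) hX hg hgb hη.le (by linarith) (ν := -(ζ * s m))
        (fun k => hmean (r, k, m)) K
      rw [hb4] at hhigh
      have hp : (1 - t) ^ K * x ≤ (1 - t / 4) ^ K * x :=
        mul_le_mul_of_nonneg_right (pow_le_pow_left₀ (by linarith) (by linarith) K) hr
      rcases hs m with h | h | h
      · refine le_trans ?_ hhigh
        simp only [h, if_true]
        linarith
      · refine le_trans ?_ hlow
        simp only [h]
        norm_num
        linarith
      · refine le_trans ?_ hlow
        simp [h]
        rfl
    refine le_trans ?_ (Finset.sum_le_sum fun m _ => hclient m)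
    rw [Finset.sum_add_distrib, Finset.sum_add_distrib, Fin.sum_const, nsmul_eq_mul,
      ← Finset.mul_sum, ← Finset.mul_sum, hs0]
    have := mul_le_mul_of_nonneg_left hs1 (by positivity : 0 ≤ η * ζ * (B - A))
    linarith

/-! ### From the curvature `h` to the stated rates -/

theorem rpow_third_mul_pow {x : ℝ} (hx : 0 ≤ x) :
    (x ^ (1 / 3 : ℝ)) ^ 3 = x ∧ (x ^ (2 / 3 : ℝ)) ^ 3 = x ^ 2 ∧ (x ^ (4 / 3 : ℝ)) ^ 3 = x ^ 4 := by
  refine ⟨?_, ?_, ?_⟩ <;> rw [← Real.rpow_natCast, ← Real.rpow_mul hx] <;> norm_num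

section rates

universe u

variable {K R M : ℕ} {H D σ ζ : ℝ}

theorem hardInstance_variance_rate (hK : 2 ≤ K) (hR : 1 ≤ R) (hM : 1 ≤ M) (hH : 0 < H)
    (hD : 0 < D) (hσ : 0 < σ) :
    HardInstance.{u} K R M H D σ ζ (min (H * D ^ 2) (σ * D / √(M * K * R)) / 2 ^ 22) := by
  have hK' : (0 : ℝ) < K := by exact_mod_cast (by omega : 0 < K)
  have hR' : (0 : ℝ) < R := by exact_mod_cast hR
  have hM' : (0 : ℝ) < M := by exact_mod_cast hM
  have hT : (0 : ℝ) < M * K * R := by positivity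
  set W := min (H * D ^ 2) (σ * D / √(M * K * R)) with hW
  have hW0 : 0 < W := by positivity
  have h1 : W ≤ H * D ^ 2 := min_le_left _ _
  have h2 : W * √(M * K * R) ≤ σ * D :=
    (le_div_iff₀ (Real.sqrt_pos.2 hT)).1 (min_le_right _ _)
  -- `h` is read off from the target `W = h * D ^ 2`; squaring the bound on `W` gives the condition
  -- on `σ`.
  refine (hardInstance_variance (h := W / D ^ 2) (by omega) hD (by positivity) ?_ ?_).mono ?_
  · rwa [div_le_iff₀ (by positivity)]
  · have h3 := pow_le_pow_left₀ (by positivity) h2 2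
    rw [mul_pow, Real.sq_sqrt hT.le, mul_pow] at h3
    rw [div_pow, div_mul_eq_mul_div, div_mul_eq_mul_div, div_le_iff₀ (by positivity)]
    nlinarith [mul_le_mul_of_nonneg_left h3 (sq_nonneg D)]
  · rw [div_mul_cancel₀ _ (by positivity)]
    exact div_le_div_of_nonneg_left hW0.le (by norm_num) (by norm_num)

theorem hardInstance_noiseBias_rate (hK : 2 ≤ K) (hR : 1 ≤ R) (hM : 1 ≤ M) (hH : 0 < H)
    (hD : 0 < D) (hσ : 0 < σ) :
    HardInstance.{u} K R M H D σ ζ (min (H * D ^ 2) (min (σ * D / √(K * R))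
      (H ^ (1 / 3 : ℝ) * σ ^ (2 / 3 : ℝ) * D ^ (4 / 3 : ℝ)
        / ((K : ℝ) ^ (1 / 3 : ℝ) * (R : ℝ) ^ (2 / 3 : ℝ)))) / 2 ^ 22) := by
  have hK' : (0 : ℝ) < K := by exact_mod_cast (by omega : 0 < K)
  have hR' : (0 : ℝ) < R := by exact_mod_cast hR
  have hT : (0 : ℝ) < K * R := by positivity
  set W := min (H * D ^ 2) (min (σ * D / √(K * R))
      (H ^ (1 / 3 : ℝ) * σ ^ (2 / 3 : ℝ) * D ^ (4 / 3 : ℝ)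
        / ((K : ℝ) ^ (1 / 3 : ℝ) * (R : ℝ) ^ (2 / 3 : ℝ)))) with hW
  have hW0 : 0 < W := by positivity
  have h1 : W ≤ H * D ^ 2 := min_le_left _ _
  have h2 : W * √(K * R) ≤ σ * D :=
    (le_div_iff₀ (Real.sqrt_pos.2 hT)).1 ((min_le_right _ _).trans (min_le_left _ _))
  have h3 : W * ((K : ℝ) ^ (1 / 3 : ℝ) * (R : ℝ) ^ (2 / 3 : ℝ))
      ≤ H ^ (1 / 3 : ℝ) * σ ^ (2 / 3 : ℝ) * D ^ (4 / 3 : ℝ) :=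
    (le_div_iff₀ (by positivity)).1 ((min_le_right _ _).trans (min_le_right _ _))
  have e : 8 * (W / (8 * D ^ 2)) = W / D ^ 2 := by field_simp
  -- Here `8 * h * D ^ 2 = W`, and the factor 8 turns `2 ^ 19` into `2 ^ 22`. The second condition
  -- is the squared bound on `W`, the third the cubed one.
  refine (hardInstance_noiseBias (h := W / (8 * D ^ 2)) hK (by omega) hD hσ (by positivity)
    ?_ ?_ ?_).mono ?_
  · rwa [e, div_le_iff₀ (by positivity)]
  · have h4 := pow_le_pow_left₀ (by positivity) h2 2
    rw [mul_pow, Real.sq_sqrt hT.le, mul_pow] at h4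
    rw [e, div_pow, div_mul_eq_mul_div, div_mul_eq_mul_div, div_le_iff₀ (by positivity)]
    nlinarith [mul_le_mul_of_nonneg_left h4 (sq_nonneg D)]
  · have h4 := pow_le_pow_left₀ (by positivity) h3 3
    simp only [mul_pow, (rpow_third_mul_pow hH.le).1, (rpow_third_mul_pow hσ.le).2.1,
      (rpow_third_mul_pow hD.le).2.2, (rpow_third_mul_pow hK'.le).1,
      (rpow_third_mul_pow hR'.le).2.1] at h4
    rw [e, div_pow, div_mul_eq_mul_div, div_mul_eq_mul_div, div_le_iff₀ (by positivity)]
    nlinarith [mul_le_mul_of_nonneg_left h4 (sq_nonneg D)]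
  · refine le_of_eq ?_
    field_simp
    norm_num

theorem hardInstance_heterogeneous_rate (hK : 2 ≤ K) (hR : 1 ≤ R) (hM : 2 ≤ M) (hH : 0 < H)
    (hD : 0 < D) (hζ : 0 < ζ) :
    HardInstance.{u} K R M H D σ ζ (min (H * D ^ 2) (min (ζ ^ 2 / H)
      (H ^ (1 / 3 : ℝ) * ζ ^ (2 / 3 : ℝ) * D ^ (4 / 3 : ℝ) / (R : ℝ) ^ (2 / 3 : ℝ))) / 2 ^ 22) := by
  have hR' : (0 : ℝ) < R := by exact_mod_cast hR
  set W := min (H * D ^ 2) (min (ζ ^ 2 / H)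
      (H ^ (1 / 3 : ℝ) * ζ ^ (2 / 3 : ℝ) * D ^ (4 / 3 : ℝ) / (R : ℝ) ^ (2 / 3 : ℝ))) with hW
  have hW0 : 0 < W := by positivity
  have h1 : W ≤ H * D ^ 2 := min_le_left _ _
  have h2 : W * H ≤ ζ ^ 2 := (le_div_iff₀ hH).1 ((min_le_right _ _).trans (min_le_left _ _))
  have h3 : W * (R : ℝ) ^ (2 / 3 : ℝ) ≤ H ^ (1 / 3 : ℝ) * ζ ^ (2 / 3 : ℝ) * D ^ (4 / 3 : ℝ) :=
    (le_div_iff₀ (by positivity)).1 ((min_le_right _ _).trans (min_le_right _ _))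
  have e : 8 * (W / (8 * D ^ 2)) = W / D ^ 2 := by field_simp
  refine (hardInstance_heterogeneous (h := W / (8 * D ^ 2)) hK hM hD hζ (by positivity)
    ?_ ?_ ?_).mono ?_
  · rwa [e, div_le_iff₀ (by positivity)]
  · rwa [e, div_mul_cancel₀ _ (by positivity)]
  · have h4 := pow_le_pow_left₀ (by positivity) h3 3
    simp only [mul_pow, (rpow_third_mul_pow hH.le).1, (rpow_third_mul_pow hζ.le).2.1,
      (rpow_third_mul_pow hD.le).2.2, (rpow_third_mul_pow hR'.le).2.1] at h4
    rw [e, div_pow, div_mul_eq_mul_div, div_mul_eq_mul_div, div_le_iff₀ (by positivity)]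
    nlinarith [mul_le_mul_of_nonneg_left h4 (sq_nonneg D)]
  · refine le_of_eq ?_
    field_simp
    norm_num

theorem min_add_add_add_le {A a b c d : ℝ} (hA : 0 ≤ A) :
    min A (a + b + c + d) / 2 ^ 24 ≤ min A a / 2 ^ 22 ∨
    min A (a + b + c + d) / 2 ^ 24 ≤ min A b / 2 ^ 22 ∨
    min A (a + b + c + d) / 2 ^ 24 ≤ min A c / 2 ^ 22 ∨
    min A (a + b + c + d) / 2 ^ 24 ≤ min A d / 2 ^ 22 := by
  by_contra! h
  obtain ⟨h1, h2, h3, h4⟩ := h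
  have h5 := min_le_left A (a + b + c + d)
  have h6 := min_le_right A (a + b + c + d)
  have hlt : ∀ x, min A x / 2 ^ 22 < min A (a + b + c + d) / 2 ^ 24 →
      4 * x < min A (a + b + c + d) := fun x hx => by
    rcases min_choice A x with h | h <;> rw [h] at hx <;> linarith
  linarith [hlt a h1, hlt b h2, hlt c h3, hlt d h4]

end rates

end FedAvg

end

theorem mainTheorem1 :
    ∃ c : ℝ, 0 < c ∧
      ∀ (K R M : ℕ) (H D σ ζ : ℝ), 2 ≤ K → 1 ≤ R → 1 ≤ M →
        0 < H → 0 < D → 0 ≤ σ → 0 ≤ ζ → (2 ≤ M ∨ ζ = 0) →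
        ∃ (d : ℕ) (Ξ : Type) (_ : MeasurableSpace Ξ)
          (f : EuclideanSpace ℝ (Fin d) → Ξ → ℝ)
          (𝒟 : Fin M → ProbabilityMeasure Ξ)
          (xstar x₀ : EuclideanSpace ℝ (Fin d)),
          (∀ m, FedAvg.ConvexSmoothBoundedVariance f (𝒟 m : Measure Ξ) H σ) ∧
          (∀ x, FedAvg.globalLoss f 𝒟 xstar ≤ FedAvg.globalLoss f 𝒟 x) ∧
          FedAvg.HeterogeneityAtMost f 𝒟 xstar ζ ∧
          (ζ = 0 → ∀ m m', 𝒟 m = 𝒟 m') ∧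
          ‖x₀ - xstar‖ < D ∧
          ∀ (η : ℝ) (Ω : Type*) (_ : MeasurableSpace Ω) (P : Measure Ω)
            (_ : IsProbabilityMeasure P) (ξ : ℕ → ℕ → Fin M → Ω → Ξ),
            FedAvg.IsSampling ξ 𝒟 P →
            Integrable (fun ω => FedAvg.globalLoss f 𝒟
              (FedAvg.serverIterate f η K (fun r k m => ξ r k m ω) x₀ R)) P ∧
            c * min (H * D ^ 2)
                (H * D ^ 2 / (K * R)
                  + σ * D / √(M * K * R)
                  + min (σ * D / √(K * R))
                      (H ^ (1 / 3 : ℝ) * σ ^ (2 / 3 : ℝ) * D ^ (4 / 3 : ℝ)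
                        / ((K : ℝ) ^ (1 / 3 : ℝ) * (R : ℝ) ^ (2 / 3 : ℝ)))
                  + min (ζ ^ 2 / H)
                      (H ^ (1 / 3 : ℝ) * ζ ^ (2 / 3 : ℝ) * D ^ (4 / 3 : ℝ)
                        / (R : ℝ) ^ (2 / 3 : ℝ)))
              ≤ (∫ ω, FedAvg.globalLoss f 𝒟
                  (FedAvg.serverIterate f η K (fun r k m => ξ r k m ω) x₀ R) ∂P)
                - FedAvg.globalLoss f 𝒟 xstar := by
  refine ⟨1 / 2 ^ 24, by norm_num, fun K R M H D σ ζ hK hR hM hH hD hσ hζ hMζ => ?_⟩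
  rw [one_div_mul_eq_div]
  change FedAvg.HardInstance K R M H D σ ζ _
  have hK' : (0 : ℝ) < K := by exact_mod_cast (by omega : 0 < K)
  have hR' : (0 : ℝ) < R := by exact_mod_cast hR
  have hbase := FedAvg.hardInstance_quadratic (σ := σ) (ζ := ζ) (K := K) (R := R) (M := M)
    (by omega) hR (by omega) hH hD
  have hHD : 0 ≤ H * D ^ 2 := by positivity
  have hpos : 0 ≤ H * D ^ 2 / (K * R) := by positivity
  -- When `σ = 0` or `ζ = 0` the corresponding term vanishes, and the deterministic quadratic serves
  -- as the instance.
  have htriv : ∀ a, a ≤ 0 → FedAvg.HardInstance K R M H D σ ζ (min (H * D ^ 2) a / 2 ^ 22) :=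
    fun a ha => hbase.mono (by linarith [min_le_right (H * D ^ 2) a])
  rcases FedAvg.min_add_add_add_le (a := H * D ^ 2 / (K * R)) (b := σ * D / √(M * K * R))
    (c := min (σ * D / √(K * R)) (H ^ (1 / 3 : ℝ) * σ ^ (2 / 3 : ℝ) * D ^ (4 / 3 : ℝ)
      / ((K : ℝ) ^ (1 / 3 : ℝ) * (R : ℝ) ^ (2 / 3 : ℝ))))
    (d := min (ζ ^ 2 / H) (H ^ (1 / 3 : ℝ) * ζ ^ (2 / 3 : ℝ) * D ^ (4 / 3 : ℝ)
      / (R : ℝ) ^ (2 / 3 : ℝ))) hHD with h | h | h | h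
  · exact hbase.mono (h.trans (by linarith [min_le_right (H * D ^ 2) (H * D ^ 2 / (K * R))]))
  · refine FedAvg.HardInstance.mono ?_ h
    rcases hσ.eq_or_lt with rfl | hσ
    · exact htriv _ (by simp)
    · exact FedAvg.hardInstance_variance_rate hK hR hM hH hD hσ
  · refine FedAvg.HardInstance.mono ?_ h
    rcases hσ.eq_or_lt with rfl | hσ
    · exact htriv _ ((min_le_left _ _).trans (by simp))
    · exact FedAvg.hardInstance_noiseBias_rate hK hR hM hH hD hσ
  · refine FedAvg.HardInstance.mono ?_ h
    rcases hζ.eq_or_lt with rfl | hζ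
    · exact htriv _ ((min_le_left _ _).trans (by simp))
    · exact FedAvg.hardInstance_heterogeneous_rate hK hR (hMζ.resolve_right hζ.ne') hH hD hζ
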